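/- **Setting.** Convenient calculus is that of Frölicher–Kriegl–Michor. A convenient space is a Hausdorff locally convex real vector space in which Mackey–Cauchy sequences converge. Its $c^\infty$-topology is the final topology for the smooth curves $\mathbb R\to\mathbb E$. A map on a $c^\infty$-open set is smooth if it sends smooth curves to smooth curves. Let $M$ be a convenient manifold modelled on a convenient space $\mathbb M$; its charts are homeomorphisms onto $c^\infty$-open sets, with smooth changes of charts. Let $\mathbb M'$ be the bornological dual of $\mathbb M$ and $T'M$ the kinematic cotangent bundle. Let $T^\flat M\subset T'M$ be a weak subbundle: its typical fibre $\mathbb M^\flat$ is a convenient space, and $M$ is covered by charts (called trivializing) in whose trivialization of $T'M$ the bundle $T^\flat M$ is the constant bundle with fibre $\mathbb M^\flat\hookrightarrow\mathbb M'$ (a bounded injection), the transition maps between these fibres being smooth. For $U\subset M$ open, $\mathfrak A(U)$ is the set of $f\in C^\infty(U)$ such that $d^k_xf(\cdot,u_2,\dots,u_k)\in T^\flat_xM$ for all $k\ge1$, $x\in U$, $u_i\in T_xM$ (higher differentials being taken in a trivializing chart). Let $P:T^\flat M\to TM$ be a smooth bundle morphism with $\langle\xi,P\eta\rangle=-\langle\eta,P\xi\rangle$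 such that the bracket $\{f,g\}=-\langle df,P(dg)\rangle$ satisfies the Jacobi identity on every $\mathfrak A(U)$ (a partial Poisson structure). The characteristic distribution is $\mathcal D_x=P(T^\flat_xM)\subset T_xM$. For $U$ open, $\operatorname{Cas}_P(U)$ is the set of $C\in\mathfrak A(U)$ with $\{C,f\}=0$ for all $f\in\mathfrak A(U)$. We call $C$ a *local Casimir function* on $U$ if $C|_V\in\operatorname{Cas}_P(V)$ for every open $V\subset U$. **Proposition.** Let $U\subset M$ be open. 1. Let $C$ be a local Casimir function on $U$. * (a) Let $N$ be a submanifold of $M$ (locally, in a smooth chart, a $c^\infty$-closed linear subspace); in particular $N$ may be any closed submanifold. If $T_xN\subset\mathcal D_x$ for all $x\in N$, then $C$ is constant on every connected component of $U\cap N$. * (b) In particular, let $N$ be a leaf of $\mathcal D$ that is a closed submanifold, i.e. a closed connected submanifold with $T_xN=\mathcal D_x$ for all $x\in N$. If $U\cap N$ is connected (e.g. if $N\subset U$), then $C$ is constant on $U\cap N$. * (c) More generally, let $\iota:L\to M$ be a weak submanifold (an injective smooth map of convenient manifolds with injective tangent maps) with $T_z\iota(T_zL)\subset\mathcal D_{\iota(z)}$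 for all $z\in L$; e.g. any leaf of $\mathcal D$, closed or not. Then $C\circ\iota$ is constant on every connected component of $\iota^{-1}(U)$. 2. Let $C\in\operatorname{Cas}_P(U)$. * (a) If $U$ is contained in the domain of a trivializing chart, then $C$ is a local Casimir function on $U$, so that 1. applies to it. * (b) For arbitrary open $U$ and every $H\in\mathfrak A(U)$, $C$ is constant along every integral curve $c:I\to U$ ($I$ an open interval) of the Hamiltonian vector field $X_H=P(dH)$. -/

import Mathlib

open Set Filter Topology

noncomputable section

namespace Convenient

/-! ### Convenient vector spaces, smooth curves, the `c^∞`-topology, smooth maps -/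

/-- A convenient vector space: a Hausdorff locally convex real topological vector space in which
every Mackey-Cauchy sequence converges. A sequence is Mackey-Cauchy if, for some bounded absolutely
convex set `B`, it is a Cauchy sequence of the seminormed space spanned by `B`. -/
class ConvenientSpace (E : Type*) [AddCommGroup E] [Module ℝ E] [TopologicalSpace E] : Prop
    extends IsTopologicalAddGroup E, ContinuousSMul ℝ E, LocallyConvexSpace ℝ E, T2Space E where
  mackey_complete : ∀ (x : ℕ → E) (B : Set E), Bornology.IsVonNBounded ℝ B → AbsConvex ℝ B →
    (∀ ε : ℝ, 0 < ε → ∃ n₀ : ℕ, ∀ n m : ℕ, n₀ ≤ m → m < n →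
      ∃ b ∈ B, x m - x n = ε • b) →
    ∃ a : E, Tendsto x atTop (𝓝 a)

section Calculus

variable {E F : Type*} [AddCommGroup E] [Module ℝ E] [TopologicalSpace E]
  [AddCommGroup F] [Module ℝ F] [TopologicalSpace F]

/-- The curve `c` has derivative `v` at the time `t`. -/
def HasCurveDeriv (c : ℝ → E) (v : E) (t : ℝ) : Prop :=
  Tendsto (fun s : ℝ => s⁻¹ • (c (t + s) - c t)) (𝓝[≠] 0) (𝓝 v)

/-- `c` is infinitely differentiable at the points of `I` (used for open sets `I`):
`d n` is the `n`-th derivative. -/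
def SmoothCurveOn (c : ℝ → E) (I : Set ℝ) : Prop :=
  ∃ d : ℕ → ℝ → E, (∀ t ∈ I, d 0 t = c t) ∧
    ∀ n, ∀ t ∈ I, HasCurveDeriv (d n) (d (n + 1) t) t

/-- Smooth curves `ℝ → E`, the elements of `C^∞(ℝ, E)`. -/
def SmoothCurve (c : ℝ → E) : Prop := SmoothCurveOn c univ

/-- The space `E` with its `c^∞`-topology instead of the locally convex one. -/
def CInf (E : Type*) : Type _ := E

/-- The identity, seen as a map from `E` to `E` with the `c^∞`-topology. -/
def toCInf {E : Type*} : E ≃ CInf E := Equiv.refl E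

/-- The `c^∞`-topology: the final topology with respect to all smooth curves `ℝ → E`. -/
instance : TopologicalSpace (CInf E) where
  IsOpen U := ∀ c : ℝ → E, SmoothCurve c → IsOpen {t | toCInf (c t) ∈ U}
  isOpen_univ := fun _ _ => by simp
  isOpen_inter := fun _ _ hU hV c hc => (hU c hc).inter (hV c hc)
  isOpen_sUnion := fun S hS c hc => by
    have : {t | toCInf (c t) ∈ ⋃₀ S} = ⋃ U ∈ S, {t | toCInf (c t) ∈ U} := by
      ext t; simp
    rw [this]
    exact isOpen_biUnion fun U hU => hS U hU c hc

/-- `f` is (conveniently) smooth on `U` (used for `c^∞`-open sets `U`): it maps smooth curves in `U`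
to smooth curves. -/
def ConvSmoothOn (f : E → F) (U : Set E) : Prop :=
  ∀ c : ℝ → E, SmoothCurve c → (∀ t, c t ∈ U) → SmoothCurve (f ∘ c)

/-- The differential `df(x) v = lim_{t → 0} (f (x + t v) - f x) / t`. -/
def dirDeriv (f : E → F) (x v : E) : F :=
  limUnder (𝓝[≠] (0 : ℝ)) fun t : ℝ => t⁻¹ • (f (x + t • v) - f x)

/-- The higher differential `dᵏf(x)(u₁, …, u_k)`, as an iterated directional derivative. -/
def iterDeriv : List E → (E → ℝ) → E → ℝ
  | [], f => f
  | u :: us, f => iterDeriv us fun y => dirDeriv f y u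

variable (E) in
/-- The bornological dual `E'` of bounded linear forms. -/
def bornDual : Submodule ℝ (E →ₗ[ℝ] ℝ) where
  carrier := {l | ∀ B : Set E, Bornology.IsVonNBounded ℝ B → ∃ K : ℝ, ∀ u ∈ B, |l u| ≤ K}
  zero_mem' := fun _ _ => ⟨0, by simp⟩
  add_mem' := by
    intro l m hl hm B hB
    obtain ⟨K, hK⟩ := hl B hB
    obtain ⟨K', hK'⟩ := hm B hB
    exact ⟨K + K', fun u hu => (abs_add_le _ _).trans (add_le_add (hK u hu) (hK' u hu))⟩
  smul_mem' := by
    intro r l hl B hB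
    obtain ⟨K, hK⟩ := hl B hB
    refine ⟨|r| * K, fun u hu => ?_⟩
    simpa [abs_mul] using mul_le_mul_of_nonneg_left (hK u hu) (abs_nonneg r)

end Calculus

/-! ### Convenient manifolds -/

section Charts

variable {E M X : Type*} [AddCommGroup E] [Module ℝ E] [TopologicalSpace E] [TopologicalSpace M]

/-- A chart as a map to the vector space `E`. -/
def chartMap (e : OpenPartialHomeomorph M (CInf E)) (x : M) : E := toCInf.symm (e x)

/-- The expression `f ∘ e⁻¹` of `f` in the chart `e`. -/
def chartFun (e : OpenPartialHomeomorph M (CInf E)) (f : M → X) (y : E) : X := f (e.symm (toCInf y))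

/-- The image `e(U ∩ source e)`. -/
def chartImage (e : OpenPartialHomeomorph M (CInf E)) (U : Set M) : Set E :=
  {y | toCInf y ∈ e.target ∧ e.symm (toCInf y) ∈ U}

/-- The change of charts `e' ∘ e⁻¹`, on `chartImage e e'.source`. -/
def chartChange (e e' : OpenPartialHomeomorph M (CInf E)) : E → E := chartFun e (chartMap e')

end Charts

/-- A convenient manifold modelled on the convenient space `E`: the charts are homeomorphisms onto
`c^∞`-open subsets of `E`, and the changes of charts are smooth. -/
class ConvenientManifold (E M : Type*) [AddCommGroup E] [Module ℝ E] [TopologicalSpace E]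
    [TopologicalSpace M] [ChartedSpace (CInf E) M] : Prop where
  compatible : ∀ e ∈ atlas (CInf E) M, ∀ e' ∈ atlas (CInf E) M,
    ConvSmoothOn (chartChange e e') (chartImage e e'.source)

section Manifold

variable {E M : Type*} [AddCommGroup E] [Module ℝ E] [TopologicalSpace E]
  [TopologicalSpace M] [ChartedSpace (CInf E) M]

/-- The charts of the maximal smooth atlas. -/
def IsSmoothChart (e : OpenPartialHomeomorph M (CInf E)) : Prop :=
  ∀ a ∈ atlas (CInf E) M,
    ConvSmoothOn (chartChange e a) (chartImage e a.source) ∧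
    ConvSmoothOn (chartChange a e) (chartImage a e.source)

variable (E) in
/-- The restriction of `f` to the open set `U` belongs to `C^∞(U)`. -/
def SmoothFunOn (f : M → ℝ) (U : Set M) : Prop :=
  ∀ a ∈ atlas (CInf E) M, ConvSmoothOn (chartFun a f) (chartImage a U)

variable (E) in
/-- `N` is a submanifold of `M`: around each of its points there is a smooth chart of `M` in which
`N` is a `c^∞`-closed linear subspace `S` of `E`. -/
def IsSubmanifold (N : Set M) : Prop :=
  ∀ x ∈ N, ∃ φ : OpenPartialHomeomorph M (CInf E), IsSmoothChart φ ∧ x ∈ φ.source ∧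
    ∃ S : Submodule ℝ E, IsClosed {y : CInf E | toCInf.symm y ∈ S} ∧
      ∀ y ∈ φ.source, y ∈ N ↔ chartMap φ y ∈ S

/-- The (kinematic) tangent space `T_x N ⊆ T_x M`, read in the chart `e`: the velocities at `x` of
the smooth curves in `N`. -/
def tangentSet (e : OpenPartialHomeomorph M (CInf E)) (N : Set M) (x : M) : Set E :=
  {v | ∃ γ : ℝ → E, SmoothCurve γ ∧ γ 0 = chartMap e x ∧ (∀ t, γ t ∈ chartImage e N) ∧
    HasCurveDeriv γ v 0}

variable {E' L : Type*} [AddCommGroup E'] [Module ℝ E'] [TopologicalSpace E']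
  [TopologicalSpace L] [ChartedSpace (CInf E') L]

/-- The tangent map `T_z f`, read in the charts `a` around `z` and `e` around `f z`. -/
def tangentMap (a : OpenPartialHomeomorph L (CInf E')) (e : OpenPartialHomeomorph M (CInf E))
    (f : L → M) (z : L) : E' → E :=
  dirDeriv (chartFun a fun w => chartMap e (f w)) (chartMap a z)

variable (E' E) in
/-- `f : L → M` is a weak submanifold of `M`: an injective smooth map between convenient manifolds,
all of whose tangent maps are injective. -/
def IsWeakSubmanifold (f : L → M) : Prop :=
  Continuous f ∧
  (∀ a ∈ atlas (CInf E') L, ∀ e ∈ atlas (CInf E) M,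
    ConvSmoothOn (chartFun a fun w => chartMap e (f w)) (chartImage a (f ⁻¹' e.source))) ∧
  Function.Injective f ∧
  ∀ z : L, ∀ a ∈ atlas (CInf E') L, ∀ e ∈ atlas (CInf E) M, z ∈ a.source → f z ∈ e.source →
    Function.Injective (tangentMap a e f z)

end Manifold

/-! ### Partial Poisson structures -/

/-- A weak subbundle `T♭M` of the kinematic cotangent bundle `T'M`, with typical fibre the
convenient space `F`. It is given by a covering family of smooth charts `e` of `M`; in the
trivialization of `T'M` over such a chart, `T♭M` is the trivial bundle with fibre `F`, included in
`E'` by a bounded injection `incl e` (bounded for the structure of `E'`, where a set is bounded if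
it is uniformly bounded on the bounded sets of `E`). The transition maps `α ↦ α ∘ d(e' ∘ e⁻¹)` of
`T'M` restrict to smooth maps between these fibres. -/
structure WeakCotangentSubbundle (E F M : Type*) [AddCommGroup E] [Module ℝ E] [TopologicalSpace E]
    [AddCommGroup F] [Module ℝ F] [TopologicalSpace F]
    [TopologicalSpace M] [ChartedSpace (CInf E) M] where
  charts : Set (OpenPartialHomeomorph M (CInf E))
  isSmoothChart : ∀ e ∈ charts, IsSmoothChart e
  cover : ∀ x : M, ∃ e ∈ charts, x ∈ e.source
  incl : OpenPartialHomeomorph M (CInf E) → F →ₗ[ℝ] bornDual E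
  incl_injective : ∀ e ∈ charts, Function.Injective (incl e)
  incl_bounded : ∀ e ∈ charts, ∀ A : Set F, Bornology.IsVonNBounded ℝ A →
    ∀ B : Set E, Bornology.IsVonNBounded ℝ B →
      ∃ K : ℝ, ∀ α ∈ A, ∀ u ∈ B, |(incl e α : E →ₗ[ℝ] ℝ) u| ≤ K
  transition : ∀ e ∈ charts, ∀ e' ∈ charts, ∃ τ : E × F → F,
    ConvSmoothOn τ (chartImage e e'.source ×ˢ univ) ∧
    ∀ y ∈ chartImage e e'.source, ∀ (α : F) (v : E),
      (incl e (τ (y, α)) : E →ₗ[ℝ] ℝ) v =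
        (incl e' α : E →ₗ[ℝ] ℝ) (dirDeriv (chartChange e e') y v)

section Poisson

variable {E F M : Type*} [AddCommGroup E] [Module ℝ E] [TopologicalSpace E]
  [AddCommGroup F] [Module ℝ F] [TopologicalSpace F]
  [TopologicalSpace M] [ChartedSpace (CInf E) M]

namespace WeakCotangentSubbundle

variable (T : WeakCotangentSubbundle E F M)

/-- The algebra `𝔄(U)`: smooth functions on `U` such that `dᵏf(x)(·, u₂, …, u_k)` lies in `T♭ₓM`
for all `k ≥ 1`, `x ∈ U` and `u₂, …, u_k`. Higher differentials are taken in a chart that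
trivializes `T♭M`; by smoothness of the transition maps of `T♭M`, the condition does not depend on
this chart. -/
def admissible (U : Set M) : Set (M → ℝ) :=
  {f | SmoothFunOn E f U ∧ ∀ x ∈ U, ∃ e ∈ T.charts, x ∈ e.source ∧
    ∀ us : List E, ∃ α : F, ∀ u : E,
      iterDeriv (u :: us) (chartFun e f) (chartMap e x) = (T.incl e α : E →ₗ[ℝ] ℝ) u}

/-- A chosen trivializing chart around `x`. -/
def chartAt (x : M) : OpenPartialHomeomorph M (CInf E) := (T.cover x).choose

/-- The differential `dₓf`, as an element of the fibre of `T♭M` in the chart `e`. -/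
def diff (e : OpenPartialHomeomorph M (CInf E)) (f : M → ℝ) (x : M) : F :=
  Classical.epsilon fun α : F => ∀ u : E,
    (T.incl e α : E →ₗ[ℝ] ℝ) u = dirDeriv (chartFun e f) (chartMap e x) u

end WeakCotangentSubbundle

/-- An antisymmetric smooth bundle morphism `P : T♭M → TM`, given by its local expressions `loc e` in
the trivializing charts of `T♭M`. If `α'` (in the chart `e'`) and `α` (in the chart `e`) represent
the same covector, then their images represent the same tangent vector. -/
structure PoissonAnchor (T : WeakCotangentSubbundle E F M) where
  loc : OpenPartialHomeomorph M (CInf E) → E → F →ₗ[ℝ] E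
  smooth : ∀ e ∈ T.charts,
    ConvSmoothOn (fun p : E × F => loc e p.1 p.2) (chartImage e univ ×ˢ univ)
  compatible : ∀ e ∈ T.charts, ∀ e' ∈ T.charts, ∀ x ∈ e.source ∩ e'.source, ∀ α α' : F,
    (∀ v : E, (T.incl e α : E →ₗ[ℝ] ℝ) v =
      (T.incl e' α' : E →ₗ[ℝ] ℝ) (dirDeriv (chartChange e e') (chartMap e x) v)) →
    loc e' (chartMap e' x) α' =
      dirDeriv (chartChange e e') (chartMap e x) (loc e (chartMap e x) α)
  antisymm : ∀ e ∈ T.charts, ∀ x ∈ e.source, ∀ α β : F,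
    (T.incl e α : E →ₗ[ℝ] ℝ) (loc e (chartMap e x) β) =
      -(T.incl e β : E →ₗ[ℝ] ℝ) (loc e (chartMap e x) α)

namespace PoissonAnchor

variable {T : WeakCotangentSubbundle E F M} (P : PoissonAnchor T)

/-- The Hamiltonian vector field `X_H = P(dH)` at `x`, read in the chart `e`. -/
def hamVec (e : OpenPartialHomeomorph M (CInf E)) (H : M → ℝ) (x : M) : E :=
  P.loc e (chartMap e x) (T.diff e H x)

/-- The bracket `{f, g} = -⟨df, P(dg)⟩`. -/
def bracket (f g : M → ℝ) (x : M) : ℝ :=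
  -dirDeriv (chartFun (T.chartAt x) f) (chartMap (T.chartAt x) x) (P.hamVec (T.chartAt x) g x)

/-- `P` defines a partial Poisson structure: its bracket satisfies the Jacobi identity. -/
def IsPartialPoisson : Prop :=
  ∀ U : Set M, IsOpen U → ∀ f ∈ T.admissible U, ∀ g ∈ T.admissible U, ∀ h ∈ T.admissible U,
    ∀ x ∈ U, P.bracket (P.bracket f g) h x + P.bracket (P.bracket g h) f x +
      P.bracket (P.bracket h f) g x = 0

/-- The characteristic distribution `P(T♭ₓM) ⊆ TₓM`, read in the chart `e`. -/
def charDist (e : OpenPartialHomeomorph M (CInf E)) (x : M) : Set E :=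
  range (P.loc e (chartMap e x))

/-- `C ∈ 𝔄(U)` Poisson-commutes with all of `𝔄(U)`. -/
def IsCasimir (U : Set M) (C : M → ℝ) : Prop :=
  C ∈ T.admissible U ∧ ∀ f ∈ T.admissible U, ∀ x ∈ U, P.bracket C f x = 0

/-- `C` is a local Casimir function on `U`: its restriction to every open subset `V` of `U`
Poisson-commutes with all of `𝔄(V)`. -/
def IsLocalCasimir (U : Set M) (C : M → ℝ) : Prop :=
  ∀ V : Set M, IsOpen V → V ⊆ U → P.IsCasimir V C

/-- `N` is a leaf of the characteristic distribution that is a closed submanifold of `M`. -/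
def IsClosedLeaf (N : Set M) : Prop :=
  IsClosed N ∧ IsConnected N ∧ IsSubmanifold E N ∧
    ∀ x ∈ N, ∀ e ∈ T.charts, x ∈ e.source → tangentSet e N x = P.charDist e x

/-- `c` is a smooth curve in `M`, defined on the open interval `I`, with `c'(t) = X_H(c(t))`. -/
def IsIntegralCurve (H : M → ℝ) (c : ℝ → M) (I : Set ℝ) : Prop :=
  IsOpen I ∧ I.OrdConnected ∧ ContinuousOn c I ∧
    ∀ e ∈ T.charts,
      SmoothCurveOn (fun t => chartMap e (c t)) (I ∩ c ⁻¹' e.source) ∧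
      ∀ t ∈ I ∩ c ⁻¹' e.source,
        HasCurveDeriv (fun t => chartMap e (c t)) (P.hamVec e H (c t)) t

end PoissonAnchor

end Poisson

end Convenient

end

open scoped ContDiff

set_option linter.unusedSectionVars false

noncomputable section

namespace Convenient

/-! ### Derivatives of curves -/

section Curves

variable {E F : Type*} [AddCommGroup E] [Module ℝ E] [TopologicalSpace E]
  [AddCommGroup F] [Module ℝ F] [TopologicalSpace F]

/-! The heart of the matter is that the differential of a local Casimir function `C` kills the
characteristic distribution. In a trivializing chart, every covector `α` of the fibre is the
differential, at each point, of the linear function `α` of the chart coordinate, and that function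
is admissible on the part of `U` inside the chart. Commuting with all these functions says `dC(Pα) =
0` (`IsCasimir.dirDeriv_eq_zero`). The test functions live only on the chart domain, which is why
restrictions of `C` to smaller open sets enter. If `U` already lies in one chart, they live on all
of `U`, and commuting with `𝔄(U)` is enough. Along an integral curve of `X_H` the derivative of `C`
is `-{C, H}`, so there nothing has to be localized.

Hence `C` has derivative zero along every smooth curve tangent to the distribution. A set is
`c^∞`-open once its preimages under smooth curves are open, so on a weak submanifold `C ∘ ι` is
locally constant. On a submanifold, given in a chart by a `c^∞`-closed subspace `S`, the
neighbourhoods come from the ambient space, and curves that leave `S` must be controlled as well. If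
such a curve met points of `S` with a wrong value of `C` at times accumulating at a good point, a
smooth curve inside `S` would run through a sequence of these points
(`exists_smoothCurve_in_submodule`), and `C` is constant along it.

The calculus underneath rests on the special curve lemma (`exists_special_curve`). It also gives the
chain rule: one smooth curve alternating between `c` and its tangent line shows that the derivative
of `f ∘ c` depends only on the velocity of `c` (`ConvSmoothOn.deriv_eq_deriv_line`). -/

theorem hasCurveDeriv_iff_slope {c : ℝ → E} {v : E} {t : ℝ} :
    HasCurveDeriv c v t ↔
      ∃ q : ℝ → E, ContinuousAt q 0 ∧ q 0 = v ∧ ∀ s, c (t + s) = c t + s • q s := by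
  constructor
  · intro h
    refine ⟨Function.update (fun s : ℝ => s⁻¹ • (c (t + s) - c t)) 0 v, ?_, by simp, ?_⟩
    · exact continuousAt_update_same.2 h
    · intro s
      rcases eq_or_ne s 0 with rfl | hs
      · simp
      · rw [Function.update_of_ne hs, smul_inv_smul₀ hs]
        abel
  · rintro ⟨q, hq, rfl, h⟩
    refine (hq.tendsto.mono_left nhdsWithin_le_nhds).congr' ?_
    filter_upwards [self_mem_nhdsWithin] with s hs
    rw [h s, add_sub_cancel_left, inv_smul_smul₀ hs]

theorem hasCurveDeriv_real_iff {φ : ℝ → ℝ} {v t : ℝ} :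
    HasCurveDeriv φ v t ↔ HasDerivAt φ v t :=
  hasDerivAt_iff_tendsto_slope_zero.symm

theorem HasCurveDeriv.unique [T2Space E] {c : ℝ → E} {v w : E} {t : ℝ}
    (hv : HasCurveDeriv c v t) (hw : HasCurveDeriv c w t) : v = w :=
  tendsto_nhds_unique hv hw

theorem HasCurveDeriv.congr {c c' : ℝ → E} {v : E} {t : ℝ} (h : HasCurveDeriv c v t)
    (hc : c' =ᶠ[𝓝 t] c) : HasCurveDeriv c' v t := by
  have h1 : Tendsto (fun s : ℝ => t + s) (𝓝[≠] 0) (𝓝 t) := by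
    have : Tendsto (fun s : ℝ => t + s) (𝓝 0) (𝓝 (t + 0)) := Continuous.tendsto (by fun_prop) 0
    rw [add_zero] at this
    exact this.mono_left nhdsWithin_le_nhds
  refine Tendsto.congr' ?_ h
  filter_upwards [h1.eventually hc] with s hs
  rw [hs, hc.self_of_nhds]

theorem hasCurveDeriv_const (x : E) (t : ℝ) : HasCurveDeriv (fun _ => x) 0 t := by
  simpa [HasCurveDeriv] using tendsto_const_nhds

theorem HasCurveDeriv.continuousLinear {c : ℝ → E} {v : E} {t : ℝ} (h : HasCurveDeriv c v t)
    (l : E →L[ℝ] F) : HasCurveDeriv (fun s => l (c s)) (l v) t := by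
  have := (l.continuous.tendsto v).comp h
  refine this.congr fun s => ?_
  simp

variable [IsTopologicalAddGroup E] [ContinuousSMul ℝ E]

theorem HasCurveDeriv.continuousAt {c : ℝ → E} {v : E} {t : ℝ} (h : HasCurveDeriv c v t) :
    ContinuousAt c t := by
  obtain ⟨q, hq, -, hc⟩ := hasCurveDeriv_iff_slope.1 h
  have h1 : ContinuousAt (fun s : ℝ => c t + (s - t) • q (s - t)) t := by
    have : ContinuousAt (fun s : ℝ => q (s - t)) t :=
      ContinuousAt.comp (f := fun s => s - t) (g := q) (by simpa using hq) (by fun_prop)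
    exact continuousAt_const.add ((continuousAt_id.sub continuousAt_const).smul this)
  refine h1.congr (Eventually.of_forall fun s => ?_)
  simp only
  rw [← hc, add_sub_cancel]

theorem HasCurveDeriv.add {c c' : ℝ → E} {v v' : E} {t : ℝ} (h : HasCurveDeriv c v t)
    (h' : HasCurveDeriv c' v' t) : HasCurveDeriv (fun s => c s + c' s) (v + v') t := by
  refine (Tendsto.add h h').congr fun s => ?_
  rw [← smul_add, add_sub_add_comm]

/-- The slope functions of `hasCurveDeriv_iff_slope` are continuous at `0` and defined there, so the
slope of a product, like that of a composite below, can be written down without excluding any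
increment. -/
theorem HasCurveDeriv.smul {φ : ℝ → ℝ} {c : ℝ → E} {r : ℝ} {v : E} {t : ℝ}
    (hφ : HasDerivAt φ r t) (h : HasCurveDeriv c v t) :
    HasCurveDeriv (fun s => φ s • c s) (r • c t + φ t • v) t := by
  obtain ⟨p, hp, rfl, hφ'⟩ := hasCurveDeriv_iff_slope.1 (hasCurveDeriv_real_iff.2 hφ)
  obtain ⟨q, hq, rfl, hc⟩ := hasCurveDeriv_iff_slope.1 h
  refine hasCurveDeriv_iff_slope.2 ⟨fun s => p s • c (t + s) + φ t • q s, ?_, by simp, ?_⟩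
  · have : ContinuousAt (fun s => c (t + s)) 0 :=
      ContinuousAt.comp (f := fun s => t + s) (g := c) (by simpa using h.continuousAt)
        (by fun_prop)
    exact (hp.smul this).add (continuousAt_const.smul hq)
  · intro s
    simp only [hφ', smul_eq_mul]
    rw [add_smul, hc s]
    module

theorem HasCurveDeriv.comp {ρ : ℝ → ℝ} {c : ℝ → E} {r : ℝ} {v : E} {t : ℝ}
    (h : HasCurveDeriv c v (ρ t)) (hρ : HasDerivAt ρ r t) :
    HasCurveDeriv (fun s => c (ρ s)) (r • v) t := by
  obtain ⟨p, hp, rfl, hρ'⟩ := hasCurveDeriv_iff_slope.1 (hasCurveDeriv_real_iff.2 hρ)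
  obtain ⟨q, hq, rfl, hc⟩ := hasCurveDeriv_iff_slope.1 h
  refine hasCurveDeriv_iff_slope.2 ⟨fun s => p s • q (s * p s), ?_, by simp, ?_⟩
  · have : ContinuousAt (fun s => q (s * p s)) 0 :=
      ContinuousAt.comp (f := fun s => s * p s) (g := q) (by simpa using hq)
        (continuousAt_id.mul hp)
    exact hp.smul this
  · intro s
    simp only [hρ', smul_eq_mul]
    rw [hc, mul_smul]



theorem hasCurveDeriv_line (x v : E) (t : ℝ) : HasCurveDeriv (fun s : ℝ => x + s • v) v t := by
  have := (hasCurveDeriv_const x t).add ((hasCurveDeriv_const v t).smul (hasDerivAt_id t))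
  simpa using this

/-! ### Smooth curves -/

/-- A curve is smooth if it belongs to a family of curves that is closed under derivatives. -/
theorem smoothCurveOn_of_family {I : Set ℝ} {A : Set (ℝ → E)}
    (h : ∀ g ∈ A, ∃ g' ∈ A, ∀ t ∈ I, HasCurveDeriv g (g' t) t) {c : ℝ → E} (hc : c ∈ A) :
    SmoothCurveOn c I := by
  choose! D hD hD' using h
  have hmem : ∀ n, D^[n] c ∈ A := fun n => by
    induction n with
    | zero => exact hc
    | succ n ih => rw [Function.iterate_succ_apply']; exact hD _ ih
  refine ⟨fun n => D^[n] c, fun t _ => rfl, fun n t ht => ?_⟩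
  simp only [Function.iterate_succ_apply']
  exact hD' _ (hmem n) t ht

theorem SmoothCurveOn.smul_comp {c : ℝ → E} {I J : Set ℝ}
    (hc : SmoothCurveOn c I) {φ ρ : ℝ → ℝ} (hφ : ContDiff ℝ ∞ φ) (hρ : ContDiff ℝ ∞ ρ)
    (hJ : MapsTo ρ J I) : SmoothCurveOn (fun t => φ t • c (ρ t)) J := by
  obtain ⟨d, hd0, hd⟩ := hc
  have key : SmoothCurveOn (fun t => φ t • d 0 (ρ t)) J := by
    -- The product and chain rules turn `ψ • d n ∘ ρ` into a sum of two such terms, so finite sums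
    -- of them form a family closed under derivatives. It is built from `d 0`, since `c` agrees with
    -- `d 0` only on `I`.
    let A : AddSubmonoid (ℝ → E) := AddSubmonoid.closure
      {g | ∃ (ψ : ℝ → ℝ) (n : ℕ), ContDiff ℝ ∞ ψ ∧ g = fun t => ψ t • d n (ρ t)}
    have hA : ∀ (ψ : ℝ → ℝ) (n : ℕ), ContDiff ℝ ∞ ψ → (fun t => ψ t • d n (ρ t)) ∈ A :=
      fun ψ n hψ => AddSubmonoid.subset_closure ⟨ψ, n, hψ, rfl⟩
    refine smoothCurveOn_of_family (A := A) (fun g hg => ?_) (hA φ 0 hφ)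
    induction hg using AddSubmonoid.closure_induction with
    | mem g hg =>
      obtain ⟨ψ, n, hψ, hg⟩ := hg
      subst hg
      have hψ' : ContDiff ℝ ∞ (deriv ψ) := by simpa using hψ.iterate_deriv 1
      have hρ' : ContDiff ℝ ∞ (deriv ρ) := by simpa using hρ.iterate_deriv 1
      refine ⟨_, add_mem (hA (deriv ψ) n hψ') (hA (fun t => ψ t * deriv ρ t) (n + 1) (hψ.mul hρ')),
        fun t ht => ?_⟩
      have h1 := (hd n _ (hJ ht)).comp
        ((hρ.differentiable (by simp)).differentiableAt (x := t)).hasDerivAt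
      have h2 := h1.smul ((hψ.differentiable (by simp)).differentiableAt (x := t)).hasDerivAt
      simpa [mul_smul] using h2
    | zero => exact ⟨0, A.zero_mem, fun t _ => hasCurveDeriv_const 0 t⟩
    | add g g' _ _ hg hg' =>
      obtain ⟨h, hh, hh'⟩ := hg
      obtain ⟨k, hk, hk'⟩ := hg'
      exact ⟨h + k, add_mem hh hk, fun t ht => (hh' t ht).add (hk' t ht)⟩
  obtain ⟨D, hD0, hD⟩ := key
  exact ⟨D, fun t ht => by simp only [hD0 t ht, hd0 _ (hJ ht)], hD⟩

theorem SmoothCurveOn.smoothCurve_comp {c : ℝ → E} {I : Set ℝ}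
    (hc : SmoothCurveOn c I) {ρ : ℝ → ℝ} (hρ : ContDiff ℝ ∞ ρ) (h : ∀ t, ρ t ∈ I) :
    SmoothCurve (fun t => c (ρ t)) := by
  change SmoothCurveOn _ univ
  simpa only [one_smul] using
    hc.smul_comp (φ := fun _ => 1) (J := univ) contDiff_const hρ fun t _ => h t

theorem SmoothCurve.comp {c : ℝ → E} (hc : SmoothCurve c) {ρ : ℝ → ℝ} (hρ : ContDiff ℝ ∞ ρ) :
    SmoothCurve (fun t => c (ρ t)) :=
  SmoothCurveOn.smoothCurve_comp hc hρ fun _ => mem_univ _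

theorem SmoothCurve.smul {c : ℝ → E} (hc : SmoothCurve c) {φ : ℝ → ℝ} (hφ : ContDiff ℝ ∞ φ) :
    SmoothCurve (fun t => φ t • c t) :=
  SmoothCurveOn.smul_comp hc hφ contDiff_id fun _ _ => mem_univ _

theorem SmoothCurve.add {c c' : ℝ → E} (hc : SmoothCurve c) (hc' : SmoothCurve c') :
    SmoothCurve (fun t => c t + c' t) := by
  obtain ⟨d, hd0, hd⟩ := hc
  obtain ⟨d', hd0', hd'⟩ := hc'
  exact ⟨fun n t => d n t + d' n t, fun t ht => by simp only [hd0 t ht, hd0' t ht],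
    fun n t ht => (hd n t ht).add (hd' n t ht)⟩

theorem smoothCurve_const (x : E) : SmoothCurve (fun _ : ℝ => x) :=
  smoothCurveOn_of_family (A := {fun _ => x, fun _ => 0}) (fun g hg => ⟨fun _ => 0, by simp, by
    rcases hg with rfl | rfl <;> exact fun t _ => hasCurveDeriv_const _ t⟩) (by simp)

theorem smoothCurve_line (x v : E) : SmoothCurve (fun s : ℝ => x + s • v) :=
  (smoothCurve_const x).add ((smoothCurve_const v).smul contDiff_id)

theorem SmoothCurve.hasCurveDeriv {c : ℝ → E} (hc : SmoothCurve c) :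
    ∃ c', SmoothCurve c' ∧ ∀ t, HasCurveDeriv c (c' t) t := by
  obtain ⟨d, hd0, hd⟩ := hc
  obtain rfl : d 0 = c := funext fun t => hd0 t trivial
  exact ⟨d 1, ⟨fun n => d (n + 1), fun _ _ => rfl, fun n => hd (n + 1)⟩, fun t => hd 0 t trivial⟩

theorem SmoothCurve.continuous {c : ℝ → E} (hc : SmoothCurve c) : Continuous c := by
  obtain ⟨c', -, h⟩ := hc.hasCurveDeriv
  exact continuous_iff_continuousAt.2 fun t => (h t).continuousAt

theorem SmoothCurve.continuousLinear {c : ℝ → E} (hc : SmoothCurve c) (l : E →L[ℝ] F) :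
    SmoothCurve (fun t => l (c t)) := by
  obtain ⟨d, hd0, hd⟩ := hc
  exact ⟨fun n t => l (d n t), fun t ht => by simp only [hd0 t ht],
    fun n t ht => (hd n t ht).continuousLinear l⟩

/-- Smoothness of curves is a local property. -/
theorem smoothCurve_of_locally [T2Space E] {c : ℝ → E}
    (h : ∀ t, ∃ g, SmoothCurve g ∧ g =ᶠ[𝓝 t] c) : SmoothCurve c := by
  let A : Set (ℝ → E) := {c | ∀ t, ∃ g, SmoothCurve g ∧ g =ᶠ[𝓝 t] c}
  refine smoothCurveOn_of_family (A := A) (fun c hc => ?_) h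
  have hd : ∀ t, ∃ v, HasCurveDeriv c v t := fun t => by
    obtain ⟨g, hg, hgc⟩ := hc t
    obtain ⟨g', -, hg'⟩ := hg.hasCurveDeriv
    exact ⟨g' t, (hg' t).congr hgc.symm⟩
  choose c' hc' using hd
  refine ⟨c', fun t => ?_, fun t _ => hc' t⟩
  obtain ⟨g, hg, hgc⟩ := hc t
  obtain ⟨g', hg1, hg'⟩ := hg.hasCurveDeriv
  refine ⟨g', hg1, ?_⟩
  filter_upwards [hgc.eventually_nhds] with s hs
  exact (hg' s).unique ((hc' s).congr hs)

/-- A smooth reparametrization with values near `t₀` that is the identity around `t₀`. -/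
theorem exists_localizing_reparam {t₀ : ℝ} {I : Set ℝ} (hI : I ∈ 𝓝 t₀) :
    ∃ ρ : ℝ → ℝ, ContDiff ℝ ∞ ρ ∧ (∀ t, ρ t ∈ I) ∧ ∀ᶠ t in 𝓝 t₀, ρ t = t := by
  obtain ⟨ε, hε, hI⟩ := Metric.mem_nhds_iff.1 hI
  let f : ContDiffBump t₀ := ⟨ε / 2, ε, by positivity, by linarith⟩
  -- The bump function is `1` near `t₀`, which gives the identity there, and `0` beyond distance
  -- `ε`, which gives the constant `t₀`.
  refine ⟨fun t => t₀ + f t * (t - t₀), ?_, fun t => hI ?_, ?_⟩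
  · have : ContDiff ℝ ∞ f := f.contDiff
    fun_prop
  · rw [Metric.mem_ball, Real.dist_eq, add_sub_cancel_left, abs_mul, abs_of_nonneg f.nonneg]
    rcases lt_or_ge (dist t t₀) ε with h | h
    · rw [Real.dist_eq] at h
      exact (mul_le_of_le_one_left (abs_nonneg _) f.le_one).trans_lt h
    · rw [f.zero_of_le_dist h]
      simpa using hε
  · filter_upwards [Metric.closedBall_mem_nhds t₀ (half_pos hε)] with t ht
    rw [f.one_of_mem_closedBall ht]
    ring

/-- The germ of a curve that is smooth near `t₀` extends to a smooth curve, with values in any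
prescribed neighbourhood. -/
theorem SmoothCurveOn.exists_extension {c : ℝ → E} {I J : Set ℝ} {t₀ : ℝ} (hI : IsOpen I)
    (hc : SmoothCurveOn c I) (ht : t₀ ∈ I) (hJ : J ∈ 𝓝 t₀) :
    ∃ g, SmoothCurve g ∧ g =ᶠ[𝓝 t₀] c ∧ ∀ t, ∃ s ∈ J, g t = c s := by
  obtain ⟨ρ, hρ, h1, h2⟩ := exists_localizing_reparam (inter_mem (hI.mem_nhds ht) hJ)
  refine ⟨fun t => c (ρ t), hc.smoothCurve_comp hρ fun t => (h1 t).1, ?_,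
    fun t => ⟨ρ t, (h1 t).2, rfl⟩⟩
  filter_upwards [h2] with t ht
  rw [ht]

end Curves

/-! ### Taylor remainders and bounded linear forms -/

/-- The mean value theorem, applied to `φ` on `[0, t]` and then to `φ₁` on `[0, η]`, gives `r = η /
t`. Any factor in `[0, 1]` will do, because it is used with absolutely convex neighbourhoods. -/
theorem exists_second_order_remainder {φ φ₁ φ₂ : ℝ → ℝ} (h : ∀ t, HasDerivAt φ (φ₁ t) t)
    (h₁ : ∀ t, HasDerivAt φ₁ (φ₂ t) t) {t : ℝ} (ht : 0 < t) :
    ∃ ξ ∈ Ioo 0 t, ∃ r ∈ Icc (0 : ℝ) 1, (t ^ 2)⁻¹ * (φ t - φ 0 - t * φ₁ 0) = r * φ₂ ξ := by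
  obtain ⟨η, hη, e⟩ := exists_hasDerivAt_eq_slope φ φ₁ ht
    (fun x _ => (h x).continuousAt.continuousWithinAt) fun x _ => h x
  obtain ⟨ξ, hξ, e'⟩ := exists_hasDerivAt_eq_slope φ₁ φ₂ hη.1
    (fun x _ => (h₁ x).continuousAt.continuousWithinAt) fun x _ => h₁ x
  refine ⟨ξ, ⟨hξ.1, hξ.2.trans hη.2⟩, η / t, ⟨by have := hη.1; positivity,
    (div_le_one ht).2 hη.2.le⟩, ?_⟩
  have hη0 : η ≠ 0 := hη.1.ne'
  rw [sub_zero] at e e'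
  rw [eq_div_iff ht.ne'] at e
  rw [eq_div_iff hη0] at e'
  field_simp
  linear_combination -e - t * e'

section LocallyConvex

variable {E F : Type*} [AddCommGroup E] [Module ℝ E] [TopologicalSpace E]
  [IsTopologicalAddGroup E] [ContinuousSMul ℝ E] [LocallyConvexSpace ℝ E]
  [AddCommGroup F] [Module ℝ F] [TopologicalSpace F]
  [IsTopologicalAddGroup F] [ContinuousSMul ℝ F] [LocallyConvexSpace ℝ F]

/-- Hahn–Banach replaces a vector-valued Taylor formula. A functional `l` separating a remainder
from `a • V`, which contains `c₂ ξ`, would give both `0 < r * l (c₂ ξ)` and `l (c₂ ξ) < r * l (c₂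
ξ)` with `r ≤ 1`. -/
theorem isVonNBounded_second_order_remainder {c c₁ c₂ : ℝ → E}
    (h : ∀ t, HasCurveDeriv c (c₁ t) t) (h₁ : ∀ t, HasCurveDeriv c₁ (c₂ t) t)
    (h₂ : Continuous c₂) :
    Bornology.IsVonNBounded ℝ
      ((fun t : ℝ => (t ^ 2)⁻¹ • (c t - c 0 - t • c₁ 0)) '' Ioc 0 1) := by
  refine (nhds_hasBasis_absConvex_open ℝ E).isVonNBounded_iff.2 fun V hV => ?_
  obtain ⟨h0, hVo, hVc⟩ := hV
  have hb := (isCompact_Icc (a := (0 : ℝ)) (b := 1)).image h₂ |>.isVonNBounded ℝ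
  have hab : Absorbs ℝ V (c₂ '' Icc 0 1) := hb (hVo.mem_nhds h0)
  have hev : ∀ᶠ a : ℝ in Bornology.cobounded ℝ, a ≠ 0 :=
    Bornology.eventually_ne_cobounded 0
  refine (hab.and hev).mono ?_
  rintro a ⟨ha, ha0⟩ _ ⟨t, ht, rfl⟩
  by_contra hq
  obtain ⟨l, hl⟩ := geometric_hahn_banach_open_point (hVc.2.smul a) (hVo.smul₀ ha0) hq
  obtain ⟨ξ, hξ, r, hr, e⟩ := exists_second_order_remainder
    (φ := fun s => l (c s)) (fun s => hasCurveDeriv_real_iff.1 ((h s).continuousLinear l))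
    (fun s => hasCurveDeriv_real_iff.1 ((h₁ s).continuousLinear l)) ht.1
  have h3 := hl _ (ha ⟨ξ, ⟨hξ.1.le, hξ.2.le.trans ht.2⟩, rfl⟩)
  have h4 := hl 0 ⟨0, h0, smul_zero a⟩
  simp only [map_smul, map_sub, smul_eq_mul, e, map_zero] at h3 h4
  have h5 : 0 < l (c₂ ξ) := by
    by_contra h
    exact absurd h4 (not_lt.2 (mul_nonpos_of_nonneg_of_nonpos hr.1 (not_lt.1 h)))
  exact absurd h3 (not_lt.2 (mul_le_of_le_one_left h5.le hr.2))

/-- A bounded linear form need not be continuous, so it cannot be applied to the limit of difference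
quotients. It is bounded on the second-order remainders, however, which leaves an error of order
`|s|` in the quotient. -/
theorem bornDual_hasCurveDeriv (l : bornDual E) {c c₁ c₂ : ℝ → E}
    (h : ∀ t, HasCurveDeriv c (c₁ t) t) (h₁ : ∀ t, HasCurveDeriv c₁ (c₂ t) t)
    (h₂ : Continuous c₂) (t : ℝ) :
    HasCurveDeriv (fun s => (l : E →ₗ[ℝ] ℝ) (c s)) ((l : E →ₗ[ℝ] ℝ) (c₁ t)) t := by
  -- The remainder bound concerns positive times only; `ε = ±1` treats the two sides of `t`.
  have key : ∀ ε : ℝ, |ε| = 1 → ∃ K : ℝ, ∀ s ∈ Ioc (0 : ℝ) 1,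
      |(l : E →ₗ[ℝ] ℝ) (c (t + ε * s)) - (l : E →ₗ[ℝ] ℝ) (c t) -
        ε * s * (l : E →ₗ[ℝ] ℝ) (c₁ t)| ≤ K * s ^ 2 := by
    intro ε hε
    have hd : ∀ s, HasDerivAt (fun s : ℝ => t + ε * s) ε s := fun s => by
      simpa using ((hasDerivAt_id s).const_mul ε).const_add t
    have hB := isVonNBounded_second_order_remainder
      (c := fun s => c (t + ε * s)) (c₁ := fun s => ε • c₁ (t + ε * s))
      (c₂ := fun s => ε • ε • c₂ (t + ε * s)) (fun s => (h _).comp (hd s))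
      (fun s => by simpa using ((h₁ _).comp (hd s)).smul (hasDerivAt_const s ε)) (by fun_prop)
    obtain ⟨K, hK⟩ := l.2 _ hB
    refine ⟨K, fun s hs => ?_⟩
    have := hK _ ⟨s, hs, rfl⟩
    simp only [mul_zero, add_zero, map_smul, map_sub, smul_eq_mul, abs_mul] at this
    rw [abs_of_pos (by have := hs.1; positivity), inv_mul_le_iff₀ (by have := hs.1; positivity)]
      at this
    rwa [mul_comm K, mul_assoc, mul_left_comm]
  obtain ⟨K, hK⟩ := key 1 (by simp)
  obtain ⟨K', hK'⟩ := key (-1) (by simp)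
  have hb : ∀ s : ℝ, s ≠ 0 → |s| ≤ 1 →
      |s⁻¹ • ((l : E →ₗ[ℝ] ℝ) (c (t + s)) - (l : E →ₗ[ℝ] ℝ) (c t)) - (l : E →ₗ[ℝ] ℝ) (c₁ t)| ≤
        max K K' * |s| := by
    intro s hs hs1
    have h1 : |(l : E →ₗ[ℝ] ℝ) (c (t + s)) - (l : E →ₗ[ℝ] ℝ) (c t) -
        s * (l : E →ₗ[ℝ] ℝ) (c₁ t)| ≤ max K K' * |s| ^ 2 := by
      rcases lt_or_gt_of_ne hs with h | h
      · have := hK' (-s) ⟨by linarith, by rwa [abs_of_neg h] at hs1⟩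
        simp only [neg_mul_neg, one_mul] at this
        refine this.trans ?_
        rw [sq_abs, neg_sq]
        exact mul_le_mul_of_nonneg_right (le_max_right _ _) (sq_nonneg s)
      · have := hK s ⟨h, by rwa [abs_of_pos h] at hs1⟩
        simp only [one_mul] at this
        refine this.trans ?_
        rw [sq_abs]
        exact mul_le_mul_of_nonneg_right (le_max_left _ _) (sq_nonneg s)
    have hpos : 0 < |s| := abs_pos.2 hs
    rw [← mul_le_mul_iff_of_pos_left hpos, ← abs_mul, smul_eq_mul, mul_sub,
      mul_inv_cancel_left₀ hs]
    exact h1.trans_eq (by ring)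
  rw [HasCurveDeriv, tendsto_iff_norm_sub_tendsto_zero]
  refine squeeze_zero' (Eventually.of_forall fun _ => norm_nonneg _) ?_
    (g := fun s => max K K' * |s|) ?_
  · filter_upwards [self_mem_nhdsWithin,
      mem_nhdsWithin_of_mem_nhds (Metric.closedBall_mem_nhds (0 : ℝ) one_pos)] with s hs hs1
    exact hb s hs (by simpa using hs1)
  · have : Tendsto (fun s : ℝ => max K K' * |s|) (𝓝 0) (𝓝 (max K K' * |0|)) :=
      Continuous.tendsto (by fun_prop) 0
    simp only [abs_zero, mul_zero] at this
    exact this.mono_left nhdsWithin_le_nhds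

theorem SmoothCurve.boundedLinear {c : ℝ → E} (hc : SmoothCurve c) (l : bornDual E) :
    SmoothCurve (fun t => (l : E →ₗ[ℝ] ℝ) (c t)) := by
  obtain ⟨d, hd0, hd⟩ := hc
  have hd' : ∀ n t, HasCurveDeriv (d n) (d (n + 1) t) t := fun n t => hd n t trivial
  exact ⟨fun n t => (l : E →ₗ[ℝ] ℝ) (d n t), fun t ht => by simp only [hd0 t ht],
    fun n t _ => bornDual_hasCurveDeriv l (hd' n) (hd' (n + 1))
      (continuous_iff_continuousAt.2 fun t => (hd' (n + 2) t).continuousAt) t⟩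

theorem SmoothCurve.hasCurveDeriv_bornDual {c : ℝ → E} (hc : SmoothCurve c) (l : bornDual E)
    {v : E} {t : ℝ} (h : HasCurveDeriv c v t) [T2Space E] :
    HasCurveDeriv (fun s => (l : E →ₗ[ℝ] ℝ) (c s)) ((l : E →ₗ[ℝ] ℝ) v) t := by
  obtain ⟨c₁, hc₁, h₁⟩ := hc.hasCurveDeriv
  obtain ⟨c₂, hc₂, h₂⟩ := hc₁.hasCurveDeriv
  rw [h.unique (h₁ t)]
  exact bornDual_hasCurveDeriv l h₁ h₂ hc₂.continuous t

end LocallyConvex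

/-! ### Curves through fast converging sequences -/

section SpecialCurve

/-- The windows `2⁻ⁿ [3/4, 5/4]` are pairwise disjoint because `2 * (3/4) > 5/4`. This lets one bump
per window be placed without overlap. -/
theorem eq_of_abs_two_pow_mul_sub_one_le {n m : ℕ} {s : ℝ} (hn : |2 ^ n * s - 1| ≤ 1 / 4)
    (hm : |2 ^ m * s - 1| ≤ 1 / 4) : n = m := by
  wlog h : n < m generalizing n m
  · rcases (not_lt.1 h).eq_or_lt with h | h
    · exact h.symm
    · exact (this hm hn h).symm
  exfalso
  obtain ⟨k, rfl⟩ := Nat.exists_eq_add_of_lt h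
  rw [abs_le] at hn hm
  have h1 : (1 : ℝ) ≤ 2 ^ k := one_le_pow₀ (by norm_num)
  have h2 : (2 : ℝ) ^ (n + k + 1) * s = 2 * 2 ^ k * (2 ^ n * s) := by ring
  rw [h2] at hm
  nlinarith

/-- The condition on the scalar functions `D n k`, the `k`-th derivatives of `D n 0`, under which
`∑ D n 0 • x n` is a smooth curve for each bounded sequence `x`. -/
structure IsFlatFamily (D : ℕ → ℕ → ℝ → ℝ) : Prop where
  hasDerivAt : ∀ n k s, HasDerivAt (D n k) (D n (k + 1) s) s
  support : ∀ n k s, D n k s ≠ 0 → |2 ^ n * s - 1| ≤ 1 / 4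
  bound : ∀ k, ∃ A, ∀ n s, |D n k s| ≤ A * s ^ 2

variable {E : Type*} [AddCommGroup E] [Module ℝ E] [TopologicalSpace E]
  [IsTopologicalAddGroup E] [ContinuousSMul ℝ E]

theorem IsFlatFamily.finsum_eq {D : ℕ → ℕ → ℝ → ℝ} (hD : IsFlatFamily D) (x : ℕ → E) {n : ℕ}
    {s : ℝ} (h : |2 ^ n * s - 1| ≤ 1 / 4) (k : ℕ) : ∑ᶠ m, D m k s • x m = D n k s • x n := by
  refine finsum_eq_single _ n fun m hm => ?_
  have : D m k s = 0 := by
    by_contra h'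
    exact hm (eq_of_abs_two_pow_mul_sub_one_le (hD.support m k s h') h)
  rw [this, zero_smul]

theorem IsFlatFamily.exists_finsum_eq {D : ℕ → ℕ → ℝ → ℝ} (hD : IsFlatFamily D) (x : ℕ → E)
    (s : ℝ) (k : ℕ) : ∃ n, ∑ᶠ m, D m k s • x m = D n k s • x n := by
  by_cases h : ∃ n, |2 ^ n * s - 1| ≤ 1 / 4
  · obtain ⟨n, hn⟩ := h
    exact ⟨n, hD.finsum_eq x hn k⟩
  · push Not at h
    have h0 : ∀ m, D m k s = 0 := fun m => by
      by_contra h'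
      exact absurd (hD.support m k s h') (not_le.2 (h m))
    exact ⟨0, by simp [h0]⟩

theorem IsFlatFamily.eval_zero {D : ℕ → ℕ → ℝ → ℝ} (hD : IsFlatFamily D) (n k : ℕ) :
    D n k 0 = 0 := by
  by_contra h
  have := hD.support n k 0 h
  norm_num at this

/-- Away from `0` the sum is locally finite. At `0` it reduces to one term at each time, and the
quadratic bound times a bounded sequence makes the difference quotients of every order tend to `0`.
-/
theorem IsFlatFamily.smoothCurve {D : ℕ → ℕ → ℝ → ℝ} (hD : IsFlatFamily D) {x : ℕ → E}
    (hx : Bornology.IsVonNBounded ℝ (range x)) :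
    SmoothCurve fun s => ∑ᶠ n, D n 0 s • x n := by
  refine ⟨fun k s => ∑ᶠ n, D n k s • x n, fun _ _ => rfl, fun k s _ => ?_⟩
  rcases eq_or_ne s 0 with rfl | hs
  · obtain ⟨A, hA⟩ := hD.bound k
    choose N hN using fun s => hD.exists_finsum_eq x s k
    have h0 : ∀ k, ∑ᶠ n, D n k 0 • x n = 0 := fun k => by simp [hD.eval_zero]
    simp only [HasCurveDeriv, zero_add, h0, sub_zero, hN]
    have h1 : Tendsto (fun s => s⁻¹ * D (N s) k s) (𝓝[≠] 0) (𝓝 0) := by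
      have h2 : Tendsto (fun s : ℝ => A * |s|) (𝓝[≠] 0) (𝓝 0) := by
        have : Tendsto (fun s : ℝ => A * |s|) (𝓝 0) (𝓝 (A * |0|)) :=
          Continuous.tendsto (by fun_prop) 0
        simp only [abs_zero, mul_zero] at this
        exact this.mono_left nhdsWithin_le_nhds
      refine squeeze_zero_norm' ?_ h2
      filter_upwards [self_mem_nhdsWithin] with s hs
      have hpos : 0 < |s| := abs_pos.2 hs
      rw [norm_mul, norm_inv, Real.norm_eq_abs, Real.norm_eq_abs, inv_mul_le_iff₀ hpos]
      refine (hA _ s).trans_eq ?_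
      rw [← sq_abs]
      ring
    have h3 := hx.smul_tendsto_zero (x := fun s => x (N s))
      (Eventually.of_forall fun s => mem_range_self _) h1
    exact h3.congr fun s => mul_smul _ _ _
  -- For `n ≥ n₀` the upper end `(5/4) 2⁻ⁿ` of the window is below `|s| / 2`, so these terms vanish
  -- near `s`.
  · obtain ⟨n₀, hn₀⟩ := pow_unbounded_of_one_lt (2 * (5 / 4) / |s|) (one_lt_two (α := ℝ))
    have hev : ∀ᶠ s' in 𝓝 s, |s| / 2 < |s'| :=
      (continuous_abs.tendsto s).eventually (lt_mem_nhds (half_lt_self (abs_pos.2 hs)))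
    have hz : ∀ s', |s| / 2 < |s'| → ∀ n, n₀ ≤ n → ∀ k, D n k s' = 0 := by
      intro s' hs' n hn k
      by_contra h
      have h1 := hD.support n k s' h
      have h2 : (2 : ℝ) ^ n₀ ≤ 2 ^ n := pow_le_pow_right₀ (by norm_num) hn
      have hpos : 0 < |s| := abs_pos.2 hs
      rw [div_lt_iff₀ hpos] at hn₀
      have h3 : |2 ^ n * s'| = 2 ^ n * |s'| := by rw [abs_mul, abs_of_pos (by positivity)]
      have h4 := abs_le.1 h1
      have h5 : |2 ^ n * s'| ≤ 5 / 4 := abs_le.2 ⟨by linarith, by linarith⟩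
      nlinarith [pow_pos (two_pos : (0 : ℝ) < 2) n₀]
    have hfin : ∀ s', |s| / 2 < |s'| → ∀ k,
        ∑ᶠ n, D n k s' • x n = ∑ n ∈ Finset.range n₀, D n k s' • x n := by
      intro s' hs' k
      refine finsum_eq_sum_of_support_subset _ fun n hn => ?_
      by_contra h
      refine hn ?_
      have := hz s' hs' n (by simpa using h) k
      simp only [this, zero_smul]
    have hsum : ∀ (S : Finset ℕ), HasCurveDeriv (fun s => ∑ n ∈ S, D n k s • x n)
        (∑ n ∈ S, D n (k + 1) s • x n) s := by
      intro S
      induction S using Finset.induction_on with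
      | empty => simpa using hasCurveDeriv_const (0 : E) s
      | insert n S hn ih =>
        simp only [Finset.sum_insert hn]
        refine HasCurveDeriv.add ?_ ih
        simpa using (hasCurveDeriv_const (x n) s).smul (hD.hasDerivAt n k s)
    simp only [hfin s (half_lt_self (abs_pos.2 hs)) (k + 1)]
    refine (hsum _).congr ?_
    filter_upwards [hev] with s' hs'
    exact hfin s' hs' k

/-- Each derivative costs a factor `2 ^ n`. On the support `2 ^ n * |s| ≥ 3/4`, so two more such
factors buy `s ^ 2`, up to `16/9`. The total `2 ^ (n * (k + 2))` is absorbed by `|a n|`, since `n (k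
+ 2) ≤ n² + (k + 2)²`. -/
theorem isFlatFamily_of_bump {a : ℕ → ℝ} (ha : ∀ n, |a n| ≤ (1 / 2) ^ (n ^ 2)) {θ : ℝ → ℝ}
    (hθ : ContDiff ℝ ∞ θ) (hs : tsupport θ ⊆ Metric.closedBall 0 (1 / 4)) :
    IsFlatFamily fun n k s => a n * (2 ^ n) ^ k * iteratedDeriv k θ (2 ^ n * s - 1) := by
  have hsupp : ∀ k u, iteratedDeriv k θ u ≠ 0 → |u| ≤ 1 / 4 := by
    intro k u hu
    have : u ∈ tsupport θ := by
      by_contra h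
      refine hu ?_
      have h1 : θ =ᶠ[𝓝 u] fun _ => 0 := notMem_tsupport_iff_eventuallyEq.1 h
      rw [h1.iteratedDeriv_eq k]
      simp
    simpa using hs this
  refine ⟨fun n k s => ?_, fun n k s h => ?_, fun k => ?_⟩
  · have h1 : HasDerivAt (fun s : ℝ => 2 ^ n * s - 1) (2 ^ n) s := by
      simpa using ((hasDerivAt_id s).const_mul ((2 : ℝ) ^ n)).sub_const 1
    have h2 : HasDerivAt (iteratedDeriv k θ) (iteratedDeriv (k + 1) θ (2 ^ n * s - 1))
        (2 ^ n * s - 1) := by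
      rw [iteratedDeriv_succ]
      exact ((hθ.differentiable_iteratedDeriv k (by exact_mod_cast ENat.natCast_lt_top k))
        _).hasDerivAt
    have h3 := (h2.comp s h1).const_mul (a n * (2 ^ n) ^ k)
    exact h3.congr_deriv (by ring)
  · exact hsupp k _ (right_ne_zero_of_mul h)
  · obtain ⟨B, hB⟩ : ∃ B, ∀ u, ‖iteratedDeriv k θ u‖ ≤ B := by
      have hc : Continuous (iteratedDeriv k θ) :=
        hθ.continuous_iteratedDeriv k (by exact_mod_cast le_top)
      have h1 := (isCompact_closedBall (0 : ℝ) (1 / 4)).exists_bound_of_continuousOn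
        hc.continuousOn
      obtain ⟨B, hB⟩ := h1
      refine ⟨max B 0, fun u => ?_⟩
      by_cases h : iteratedDeriv k θ u = 0
      · simp [h]
      · exact (hB u (by simpa using hsupp k u h)).trans (le_max_left _ _)
    have hB0 : 0 ≤ B := (norm_nonneg _).trans (hB 0)
    refine ⟨2 ^ ((k + 2) ^ 2) * B * (16 / 9), fun n s => ?_⟩
    by_cases h : iteratedDeriv k θ (2 ^ n * s - 1) = 0
    · simp only [h, mul_zero, abs_zero]
      positivity
    · have h1 := abs_le.1 (hsupp k _ h)
      have h2 : (9 / 16 : ℝ) ≤ (2 ^ n) ^ 2 * s ^ 2 := by nlinarith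
      have h3 : |a n| * (2 ^ n) ^ (k + 2) ≤ 2 ^ ((k + 2) ^ 2) := by
        have h4 : (2 : ℝ) ^ (n * (k + 2)) ≤ 2 ^ (n ^ 2) * 2 ^ ((k + 2) ^ 2) := by
          rw [← pow_add]
          refine pow_le_pow_right₀ (by norm_num) ?_
          rcases le_total n (k + 2) with h | h <;> nlinarith
        rw [← pow_mul]
        calc |a n| * 2 ^ (n * (k + 2)) ≤ (1 / 2) ^ (n ^ 2) * (2 ^ (n ^ 2) * 2 ^ ((k + 2) ^ 2)) :=
              mul_le_mul (ha n) h4 (by positivity) (by positivity)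
          _ = 2 ^ ((k + 2) ^ 2) := by
              rw [← mul_assoc, ← mul_pow]
              norm_num
      have h5 : |a n * (2 ^ n) ^ k * iteratedDeriv k θ (2 ^ n * s - 1)| ≤
          |a n| * (2 ^ n) ^ k * B := by
        rw [abs_mul, abs_mul, abs_of_pos (by positivity : (0 : ℝ) < (2 ^ n) ^ k)]
        exact mul_le_mul_of_nonneg_left (hB _) (by positivity)
      refine h5.trans ?_
      have h6 : 0 ≤ |a n| * (2 ^ n) ^ k * B := by positivity
      calc |a n| * (2 ^ n) ^ k * B
          ≤ |a n| * (2 ^ n) ^ k * B * ((2 ^ n) ^ 2 * s ^ 2 * (16 / 9)) :=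
            le_mul_of_one_le_right h6 (by linarith)
        _ = (|a n| * (2 ^ n) ^ (k + 2)) * (B * (16 / 9) * s ^ 2) := by ring
        _ ≤ 2 ^ ((k + 2) ^ 2) * (B * (16 / 9) * s ^ 2) :=
            mul_le_mul_of_nonneg_right h3 (by positivity)
        _ = _ := by ring

/-- The special curve lemma. -/
theorem exists_special_curve {a : ℕ → ℝ} (ha : ∀ n, |a n| ≤ (1 / 2) ^ (n ^ 2)) {θ : ℝ → ℝ}
    (hθ : ContDiff ℝ ∞ θ) (hs : tsupport θ ⊆ Metric.closedBall 0 (1 / 4)) {x : ℕ → E}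
    (hx : Bornology.IsVonNBounded ℝ (range x)) :
    ∃ γ : ℝ → E, SmoothCurve γ ∧ γ 0 = 0 ∧
      (∀ n u, |u| ≤ 1 / 4 → γ ((1 / 2) ^ n * (1 + u)) = (a n * θ u) • x n) ∧
      ∀ s, ∃ n, ∃ r : ℝ, γ s = r • x n := by
  have hD := isFlatFamily_of_bump ha hθ hs
  refine ⟨_, hD.smoothCurve hx, ?_, fun n u hu => ?_, fun s => ?_⟩
  · obtain ⟨n, hn⟩ := hD.exists_finsum_eq x 0 0
    rw [hn, hD.eval_zero, zero_smul]
  · have h1 : (2 : ℝ) ^ n * ((1 / 2) ^ n * (1 + u)) - 1 = u := by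
      rw [← mul_assoc, ← mul_pow]
      norm_num
    rw [hD.finsum_eq x (n := n) (by rwa [h1])]
    simp
  · obtain ⟨n, hn⟩ := hD.exists_finsum_eq x s 0
    exact ⟨n, _, hn⟩

end SpecialCurve

/-! ### Locality of smoothness and the chain rule -/

section COpen

variable {E F G : Type*} [AddCommGroup E] [Module ℝ E] [TopologicalSpace E]
  [AddCommGroup F] [Module ℝ F] [TopologicalSpace F]
  [AddCommGroup G] [Module ℝ G] [TopologicalSpace G]

/-- `O` is `c^∞`-open. -/
def COpen (O : Set E) : Prop := ∀ c : ℝ → E, SmoothCurve c → IsOpen (c ⁻¹' O)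

theorem ConvSmoothOn.mono {f : E → F} {O O' : Set E} (hf : ConvSmoothOn f O) (h : O' ⊆ O) :
    ConvSmoothOn f O' := fun c hc hO => hf c hc fun t => h (hO t)

theorem ConvSmoothOn.congr {f g : E → F} {O : Set E} (hf : ConvSmoothOn f O)
    (h : EqOn g f O) : ConvSmoothOn g O := fun c hc hO => by
  have : g ∘ c = f ∘ c := funext fun t => h (hO t)
  rw [this]
  exact hf c hc hO

theorem ConvSmoothOn.comp {g : F → G} {f : E → F} {O : Set E} {O' : Set F}
    (hg : ConvSmoothOn g O') (hf : ConvSmoothOn f O) (h : MapsTo f O O') :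
    ConvSmoothOn (fun x => g (f x)) O := fun c hc hO =>
  hg _ (hf c hc hO) fun t => h (hO t)

variable [IsTopologicalAddGroup E] [ContinuousSMul ℝ E] [IsTopologicalAddGroup F]
  [ContinuousSMul ℝ F]

theorem convSmoothOn_of_locally [T2Space F] {f : E → F} {O : Set E}
    (h : ∀ y ∈ O, ∃ O', COpen O' ∧ y ∈ O' ∧ ConvSmoothOn f (O ∩ O')) : ConvSmoothOn f O := by
  intro c hc hO
  refine smoothCurve_of_locally fun t => ?_
  obtain ⟨O', hO', ht, hf⟩ := h _ (hO t)
  obtain ⟨ρ, hρ, h1, h2⟩ := exists_localizing_reparam ((hO' c hc).mem_nhds ht)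
  refine ⟨_, hf _ (hc.comp hρ) fun s => ⟨hO _, h1 s⟩, ?_⟩
  filter_upwards [h2] with s hs
  simp only [Function.comp, hs]

/-- Smoothness of `f` is tested only on curves lying in `O` for all time, so a curve merely passing
through `O` is first reparametrized to stay there. -/
theorem ConvSmoothOn.exists_extension {f : E → F} {O : Set E} (hO : COpen O)
    (hf : ConvSmoothOn f O) {c : ℝ → E} (hc : SmoothCurve c) {t : ℝ} (ht : c t ∈ O) :
    ∃ g, SmoothCurve g ∧ g =ᶠ[𝓝 t] fun s => f (c s) := by
  obtain ⟨ρ, hρ, h1, h2⟩ := exists_localizing_reparam ((hO c hc).mem_nhds ht)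
  refine ⟨_, hf _ (hc.comp hρ) fun s => h1 s, ?_⟩
  filter_upwards [h2] with s hs
  simp only [Function.comp, hs]

theorem ConvSmoothOn.exists_hasCurveDeriv {f : E → F} {O : Set E} (hO : COpen O)
    (hf : ConvSmoothOn f O) {c : ℝ → E} (hc : SmoothCurve c) {t : ℝ} (ht : c t ∈ O) :
    ∃ v, HasCurveDeriv (fun s => f (c s)) v t := by
  obtain ⟨g, hg, hgc⟩ := hf.exists_extension hO hc ht
  obtain ⟨g', -, hg'⟩ := hg.hasCurveDeriv
  exact ⟨g' t, (hg' t).congr hgc.symm⟩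

theorem tendsto_half_pow_sq : Tendsto (fun n : ℕ => (1 / 2 : ℝ) ^ (n ^ 2)) atTop (𝓝 0) :=
  (tendsto_pow_atTop_nhds_zero_of_lt_one (by norm_num) (by norm_num)).comp
    (tendsto_pow_atTop two_ne_zero)

theorem tendsto_slope_seq {φ : ℝ → ℝ} {p : ℝ} (h : HasDerivAt φ p 0) {r : ℕ → ℝ}
    (hr : Tendsto r atTop (𝓝 0)) (hr0 : ∀ n, r n ≠ 0) :
    Tendsto (fun n => (r n)⁻¹ * (φ (r n) - φ 0)) atTop (𝓝 p) := by
  have h1 := (hasDerivAt_iff_tendsto_slope_zero.1 h).comp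
    (tendsto_nhdsWithin_iff.2 ⟨hr, Eventually.of_forall hr0⟩)
  simpa [Function.comp_def] using h1

variable [LocallyConvexSpace ℝ E]

/-- Around `0` there is a smooth curve through `x` and through infinitely many points of each of
two smooth curves which start at `x` with the same velocity, one of them being a line. -/
theorem exists_interlacing_curve {c c₁ c₂ : ℝ → E}
    (h : ∀ t, HasCurveDeriv c (c₁ t) t) (h₁ : ∀ t, HasCurveDeriv c₁ (c₂ t) t)
    (h₂ : Continuous c₂) :
    ∃ Γ : ℝ → E, SmoothCurve Γ ∧ Γ 0 = c 0 ∧ (∀ n, Γ ((1 / 2) ^ n * (3 / 4)) = c 0) ∧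
      (∀ n, Γ ((1 / 2) ^ n) = c ((1 / 2) ^ (n ^ 2))) ∧
      ∀ n, 3 ≤ n → Γ ((1 / 2) ^ n + (1 / 2) ^ (n ^ 2)) =
        c 0 + ((1 / 2 : ℝ) ^ (n ^ 2)) • c₁ 0 := by
  let t : ℕ → ℝ := fun n => (1 / 2 : ℝ) ^ (n ^ 2)
  have ht0 : ∀ n, 0 < t n := fun n => by positivity
  have ht1 : ∀ n, t n ≤ 1 := fun n => pow_le_one₀ (by norm_num) (by norm_num)
  have hy : Bornology.IsVonNBounded ℝ (range fun n => (t n)⁻¹ • (c (t n) - c 0)) := by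
    refine Tendsto.isVonNBounded_range ℝ (x := c₁ 0) ?_
    have h3 := Tendsto.comp (h 0) (tendsto_nhdsWithin_iff.2
      ⟨tendsto_half_pow_sq, Eventually.of_forall fun n => (ht0 n).ne'⟩)
    simpa only [Function.comp_def, zero_add] using h3
  have hw : Bornology.IsVonNBounded ℝ
      (range fun n => (t n ^ 2)⁻¹ • (c (t n) - c 0 - t n • c₁ 0)) := by
    refine (isVonNBounded_second_order_remainder h h₁ h₂).subset ?_
    rintro _ ⟨n, rfl⟩
    exact ⟨t n, ⟨ht0 n, ht1 n⟩, rfl⟩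
  -- The plateau `|u| ≤ 1/8` leaves room in each window for two prescribed points; at `u = -1/4`
  -- both `γ` and `η` vanish and the curve is back at `c 0`.
  let ψ : ContDiffBump (0 : ℝ) := ⟨1 / 8, 1 / 4, by norm_num, by norm_num⟩
  have hψ : ContDiff ℝ ∞ ψ := ψ.contDiff
  have hψ1 : ∀ u : ℝ, |u| ≤ 1 / 8 → ψ u = 1 := fun u hu =>
    ψ.one_of_mem_closedBall (by simpa [ψ] using hu)
  have hψ0 : ψ (-(1 / 4)) = 0 := ψ.zero_of_le_dist (by simp [ψ])
  obtain ⟨γ, hγ, hγ0, hγ1, -⟩ := exists_special_curve (a := t)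
    (fun n => (abs_of_pos (ht0 n)).le) hψ ψ.tsupport_eq.le hy
  -- On the plateau `γ` contributes `c (t n) - c 0`. The profile `u * ψ u` makes `η` vanish at `u =
  -- 0`, while at `u = 2 ^ n * t n` its coefficient is `-(t n) ^ 2`, which subtracts exactly the
  -- second-order remainder and lands on the tangent line.
  obtain ⟨η, hη, hη0, hη1, -⟩ := exists_special_curve (a := fun n => -(t n * (1 / 2) ^ n))
    (fun n => by
      rw [abs_neg, abs_of_pos (by have := ht0 n; positivity)]
      exact mul_le_of_le_one_right (ht0 n).le (pow_le_one₀ (by norm_num) (by norm_num)))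
    (contDiff_id.mul hψ) ((tsupport_mul_subset_right).trans ψ.tsupport_eq.le) hw
  refine ⟨fun s => c 0 + (γ s + η s), (smoothCurve_const _).add (hγ.add hη), by simp [hγ0, hη0],
    fun n => ?_, fun n => ?_, fun n hn => ?_⟩
  · have e : (1 / 2 : ℝ) ^ n * (3 / 4) = (1 / 2) ^ n * (1 + -(1 / 4)) := by norm_num
    have hu : |(-(1 / 4) : ℝ)| ≤ 1 / 4 := by norm_num [abs_of_pos]
    simp only [e, hγ1 n _ hu, hη1 n _ hu, hψ0]
    simp
  · have e : (1 / 2 : ℝ) ^ n = (1 / 2) ^ n * (1 + 0) := by simp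
    simp only
    rw [e, hγ1 n 0 (by simp), hη1 n 0 (by simp), hψ1 0 (by simp)]
    simp [t]
  · have hp : (0 : ℝ) < 2 ^ n := by positivity
    have e : (1 / 2 : ℝ) ^ n + (1 / 2) ^ (n ^ 2) = (1 / 2) ^ n * (1 + 2 ^ n * t n) := by
      rw [mul_add, ← mul_assoc, ← mul_pow]
      norm_num [t]
    have hu : |2 ^ n * t n| ≤ 1 / 8 := by
      rw [abs_of_pos (mul_pos hp (ht0 n))]
      -- This is where `3 ≤ n` is needed: it gives `n + 3 ≤ n ^ 2`, so the second point is still on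
      -- the plateau.
      have h3 : t n ≤ (1 / 2) ^ (n + 3) :=
        pow_le_pow_of_le_one (by norm_num) (by norm_num) (by nlinarith)
      calc 2 ^ n * t n ≤ 2 ^ n * (1 / 2) ^ (n + 3) := mul_le_mul_of_nonneg_left h3 hp.le
        _ = 1 / 8 := by
          rw [pow_add, ← mul_assoc, ← mul_pow]
          norm_num
    simp only
    rw [e, hγ1 n _ (hu.trans (by norm_num)), hη1 n _ (hu.trans (by norm_num)),
      hψ1 _ hu]
    have e1 : -(t n * (1 / 2) ^ n) * (id (2 ^ n * t n) * 1) = -(t n ^ 2) := by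
      have : (1 / 2 : ℝ) ^ n * 2 ^ n = 1 := by
        rw [← mul_pow]
        norm_num
      simp only [id]
      linear_combination -(t n ^ 2) * this
    rw [e1, mul_one, smul_inv_smul₀ (ht0 n).ne', neg_smul, smul_inv_smul₀ (pow_pos (ht0 n) 2).ne']
    change _ = c 0 + t n • c₁ 0
    abel

/-- Along the interlacing curve, `f` becomes a smooth function `g` with `g' 0 = 0`. Its mean slope
between the points on `c` and on the line is `g' ξ → 0`; since these points are `t n` apart in time,
the same slope is a difference of two difference quotients tending to `q - p`. -/
theorem ConvSmoothOn.deriv_eq_deriv_line {f : E → ℝ} {O : Set E} (hO : COpen O)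
    (hf : ConvSmoothOn f O) {c c₁ c₂ : ℝ → E}
    (h : ∀ t, HasCurveDeriv c (c₁ t) t) (h₁ : ∀ t, HasCurveDeriv c₁ (c₂ t) t)
    (h₂ : Continuous c₂) (h0 : c 0 ∈ O) {p q : ℝ} (hp : HasDerivAt (fun t => f (c t)) p 0)
    (hq : HasDerivAt (fun t : ℝ => f (c 0 + t • c₁ 0)) q 0) : p = q := by
  obtain ⟨Γ, hΓ, hΓ0, hΓ1, hΓ2, hΓ3⟩ := exists_interlacing_curve h h₁ h₂
  obtain ⟨g, hg, hgΓ⟩ := hf.exists_extension hO hΓ (t := 0) (by rwa [hΓ0])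
  obtain ⟨g', hg', hgd⟩ := hg.hasCurveDeriv
  have hgd' : ∀ t, HasDerivAt g (g' t) t := fun t => hasCurveDeriv_real_iff.1 (hgd t)
  have hs : Tendsto (fun n : ℕ => (1 / 2 : ℝ) ^ n) atTop (𝓝 0) :=
    tendsto_pow_atTop_nhds_zero_of_lt_one (by norm_num) (by norm_num)
  have ht := tendsto_half_pow_sq
  have hst : Tendsto (fun n : ℕ => (1 / 2 : ℝ) ^ n + (1 / 2) ^ (n ^ 2)) atTop (𝓝 0) := by
    simpa using hs.add ht
  have hr : Tendsto (fun n : ℕ => (1 / 2 : ℝ) ^ n * (3 / 4)) atTop (𝓝 0) := by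
    simpa using hs.mul_const (3 / 4 : ℝ)
  -- The returns to `c 0` at the times `(3/4) 2⁻ⁿ` force this.
  have h3 : g' 0 = 0 := by
    refine tendsto_nhds_unique (tendsto_slope_seq (hgd' 0) hr fun n => by positivity) ?_
    refine tendsto_const_nhds.congr' ?_
    filter_upwards [hr.eventually hgΓ] with n hn
    have h0 : g 0 = f (Γ 0) := hgΓ.self_of_nhds
    rw [hn, h0, hΓ0, hΓ1, sub_self, mul_zero]
  have hmv : ∀ n : ℕ, ∃ ξ ∈ Ioo ((1 / 2 : ℝ) ^ n) ((1 / 2) ^ n + (1 / 2) ^ (n ^ 2)),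
      g' ξ = (g ((1 / 2) ^ n + (1 / 2) ^ (n ^ 2)) - g ((1 / 2) ^ n)) /
        ((1 / 2) ^ n + (1 / 2) ^ (n ^ 2) - (1 / 2) ^ n) := fun n =>
    exists_hasDerivAt_eq_slope g g' (lt_add_of_pos_right _ (by positivity))
      (fun x _ => (hgd' x).continuousAt.continuousWithinAt) fun x _ => hgd' x
  choose ξ hξ hξ' using hmv
  have hξ0 : Tendsto ξ atTop (𝓝 0) :=
    tendsto_of_tendsto_of_tendsto_of_le_of_le hs hst (fun n => (hξ n).1.le) fun n => (hξ n).2.le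
  have h4 : Tendsto (fun n => g' (ξ n)) atTop (𝓝 0) := by
    have := (hg'.continuous.tendsto 0).comp hξ0
    rwa [h3] at this
  have hne : ∀ n : ℕ, (1 / 2 : ℝ) ^ (n ^ 2) ≠ 0 := fun n => by positivity
  have h5 := (tendsto_slope_seq hq ht hne).sub (tendsto_slope_seq hp ht hne)
  have h6 : q - p = 0 := by
    refine tendsto_nhds_unique h5 (h4.congr' ?_)
    filter_upwards [hs.eventually hgΓ, hst.eventually hgΓ, eventually_ge_atTop 3] with n h7 h8 h9
    rw [hξ', h7, h8, hΓ2, hΓ3 n h9, add_sub_cancel_left, zero_smul, add_zero, ← mul_sub,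
      sub_sub_sub_cancel_right, div_eq_inv_mul]
  linarith

variable [T2Space E] [LocallyConvexSpace ℝ F]
  [T2Space F]

theorem dirDeriv_eq {f : E → F} {x v : E} {w : F}
    (h : HasCurveDeriv (fun s : ℝ => f (x + s • v)) w 0) : dirDeriv f x v = w := by
  refine Tendsto.limUnder_eq ?_
  simpa [HasCurveDeriv] using h

/-- The chain rule for a smooth map and a smooth curve. -/
theorem ConvSmoothOn.hasCurveDeriv_comp {f : E → F} {O : Set E} (hO : COpen O)
    (hf : ConvSmoothOn f O) {c : ℝ → E} {I : Set ℝ} (hI : IsOpen I) (hc : SmoothCurveOn c I)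
    {t : ℝ} (htI : t ∈ I) (ht : c t ∈ O) {v : E} (hv : HasCurveDeriv c v t) :
    HasCurveDeriv (fun s => f (c s)) (dirDeriv f (c t) v) t := by
  obtain ⟨c', hc', hcc', -⟩ := hc.exists_extension hI htI univ_mem
  have hct : c' t = c t := hcc'.self_of_nhds
  have hv' : HasCurveDeriv c' v t := hv.congr hcc'
  obtain ⟨c₁, hc₁, h₁⟩ := hc'.hasCurveDeriv
  obtain ⟨c₂, hc₂, h₂⟩ := hc₁.hasCurveDeriv
  obtain ⟨w, hw⟩ := hf.exists_hasCurveDeriv hO hc' (t := t) (by rwa [hct])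
  obtain ⟨w', hw'⟩ := hf.exists_hasCurveDeriv hO (smoothCurve_line (c t) v) (t := 0)
    (by simpa using ht)
  -- Continuous linear forms separate the points of `F`, which reduces the claim to the scalar case,
  -- after a shift of time to `0`.
  have key : w = w' := by
    by_contra hne
    obtain ⟨l, hl⟩ := SeparatingDual.exists_ne_zero (R := ℝ) (sub_ne_zero.2 hne)
    refine hl ?_
    rw [map_sub, sub_eq_zero]
    have hlf : ConvSmoothOn (fun x => l (f x)) O := fun c hc hcO => (hf c hc hcO).continuousLinear l
    have hd : ∀ s, HasDerivAt (fun s : ℝ => t + s) 1 s := fun s => (hasDerivAt_id s).const_add t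
    refine hlf.deriv_eq_deriv_line hO (c := fun s => c' (t + s)) (c₁ := fun s => c₁ (t + s))
      (c₂ := fun s => c₂ (t + s)) (fun s => by simpa using (h₁ _).comp (hd s))
      (fun s => by simpa using (h₂ _).comp (hd s))
      (hc₂.continuous.comp (continuous_const.add continuous_id)) (by simpa [hct] using ht) ?_ ?_
    · refine hasCurveDeriv_real_iff.1 ?_
      have hw2 : HasCurveDeriv (fun s => f (c' s)) w (t + 0) := by rwa [add_zero]
      simpa using (hw2.comp (hd 0)).continuousLinear l
    · refine hasCurveDeriv_real_iff.1 ?_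
      have e : c₁ t = v := (h₁ t).unique hv'
      simpa [hct, e] using hw'.continuousLinear l
  rw [dirDeriv_eq hw', ← key]
  refine hw.congr ?_
  filter_upwards [hcc'] with s hs
  rw [hs]

theorem ConvSmoothOn.hasCurveDeriv_line {f : E → F} {O : Set E} (hO : COpen O)
    (hf : ConvSmoothOn f O) {x : E} (hx : x ∈ O) (v : E) :
    HasCurveDeriv (fun s : ℝ => f (x + s • v)) (dirDeriv f x v) 0 := by
  have := hf.hasCurveDeriv_comp hO isOpen_univ (smoothCurve_line x v) (mem_univ 0)
    (by simpa using hx) (Convenient.hasCurveDeriv_line x v 0)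
  simpa using this

theorem dirDeriv_comp [IsTopologicalAddGroup G] [ContinuousSMul ℝ G] [LocallyConvexSpace ℝ G]
    [T2Space G] {g : F → G} {f : E → F} {O : Set E} {O' : Set F} (hO : COpen O)
    (hf : ConvSmoothOn f O) (hO' : COpen O') (hg : ConvSmoothOn g O') {h : E → G}
    (hh : ∀ y ∈ O, h y = g (f y)) {x : E} (hx : x ∈ O) (hfx : f x ∈ O') (v : E) :
    dirDeriv h x v = dirDeriv g (f x) (dirDeriv f x v) := by
  obtain ⟨c, hc, hcf⟩ := hf.exists_extension hO (smoothCurve_line x v) (t := 0)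
    (by simpa using hx)
  have hcx : c 0 = f x := by simpa using hcf.self_of_nhds
  have h1 := hg.hasCurveDeriv_comp hO' isOpen_univ hc (mem_univ 0) (by rwa [hcx])
    ((hf.hasCurveDeriv_line hO hx v).congr hcf)
  rw [hcx] at h1
  refine dirDeriv_eq (h1.congr ?_)
  filter_upwards [hcf, (hO _ (smoothCurve_line x v)).mem_nhds
    (show (0 : ℝ) ∈ _ by simpa using hx)] with s hs hs'
  rw [hs, hh _ hs']

end COpen

/-! ### Charts -/

section Manifold

variable {E F M X : Type*} [AddCommGroup E] [Module ℝ E] [TopologicalSpace E]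
  [AddCommGroup F] [Module ℝ F] [TopologicalSpace F]
  [TopologicalSpace M] {e e' : OpenPartialHomeomorph M (CInf E)}

theorem cOpen_chartImage (e : OpenPartialHomeomorph M (CInf E)) {U : Set M} (hU : IsOpen U) :
    COpen (chartImage e U) := fun c hc => (e.isOpen_inter_preimage_symm hU : IsOpen _) c hc

theorem isOpen_source_inter_preimage (e : OpenPartialHomeomorph M (CInf E)) {O : Set E}
    (hO : COpen O) : IsOpen (e.source ∩ chartMap e ⁻¹' O) :=
  e.isOpen_inter_preimage (s := toCInf.symm ⁻¹' O) hO

theorem chartMap_mem_chartImage {x : M} {U : Set M} (hx : x ∈ e.source) (hU : x ∈ U) :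
    chartMap e x ∈ chartImage e U :=
  ⟨e.map_source hx, by
    change e.symm (e x) ∈ U
    rwa [e.left_inv hx]⟩

theorem chartFun_chartMap {x : M} (hx : x ∈ e.source) (f : M → X) :
    chartFun e f (chartMap e x) = f x :=
  congrArg f (e.left_inv hx)

theorem symm_mem_source {y : E} {U : Set M} (hy : y ∈ chartImage e U) :
    e.symm (toCInf y) ∈ e.source := e.map_target hy.1

theorem chartMap_symm {y : E} {U : Set M} (hy : y ∈ chartImage e U) :
    chartMap e (e.symm (toCInf y)) = y :=
  (congrArg toCInf.symm (e.right_inv hy.1)).trans (toCInf.symm_apply_apply y)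

theorem chartImage_mono {U V : Set M} (h : U ⊆ V) : chartImage e U ⊆ chartImage e V :=
  fun _ hy => ⟨hy.1, h hy.2⟩

theorem mapsTo_chartChange {U : Set M} :
    MapsTo (chartChange e e') (chartImage e (U ∩ e'.source)) (chartImage e' U) :=
  fun _ hy => chartMap_mem_chartImage hy.2.2 hy.2.1

theorem chartFun_chartChange {U : Set M} {y : E} (hy : y ∈ chartImage e (U ∩ e'.source))
    (f : M → X) : chartFun e' f (chartChange e e' y) = chartFun e f y :=
  chartFun_chartMap hy.2.2 f

variable [ConvenientSpace E] [ChartedSpace (CInf E) M] [IsTopologicalAddGroup F]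
  [ContinuousSMul ℝ F] [LocallyConvexSpace ℝ F] [T2Space F]

/-- Smoothness in the charts of the atlas implies smoothness in all smooth charts. -/
theorem IsSmoothChart.convSmoothOn_chartFun (he : IsSmoothChart e) {g : M → F} {U : Set M}
    (h : ∀ a ∈ atlas (CInf E) M, ConvSmoothOn (chartFun a g) (chartImage a U)) :
    ConvSmoothOn (chartFun e g) (chartImage e U) := by
  refine convSmoothOn_of_locally fun y hy => ?_
  let a := chartAt (CInf E) (e.symm (toCInf y))
  have ha : a ∈ atlas (CInf E) M := chart_mem_atlas _ _
  refine ⟨chartImage e a.source, cOpen_chartImage e a.open_source,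
    ⟨hy.1, mem_chart_source _ _⟩, ?_⟩
  have hsub : chartImage e U ∩ chartImage e a.source ⊆ chartImage e (U ∩ a.source) :=
    fun z hz => ⟨hz.1.1, hz.1.2, hz.2.2⟩
  refine ((h a ha).comp ((he a ha).1.mono inter_subset_right)
    (mapsTo_chartChange.mono_left hsub)).congr fun z hz => ?_
  exact (chartFun_chartChange (hsub hz) g).symm

theorem IsSmoothChart.convSmoothOn_chartChange (he : IsSmoothChart e) (he' : IsSmoothChart e') :
    ConvSmoothOn (chartChange e e') (chartImage e e'.source) :=
  he.convSmoothOn_chartFun fun a ha => (he' a ha).2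

theorem isSmoothChart_of_mem_atlas [ConvenientManifold E M] (he : e ∈ atlas (CInf E) M) :
    IsSmoothChart e := fun a ha =>
  ⟨ConvenientManifold.compatible e he a ha, ConvenientManifold.compatible a ha e he⟩

theorem IsSmoothChart.dirDeriv_chartFun (he : IsSmoothChart e) (he' : IsSmoothChart e')
    {g : M → F} {U : Set M} (hU : IsOpen U)
    (h : ∀ a ∈ atlas (CInf E) M, ConvSmoothOn (chartFun a g) (chartImage a U)) {x : M}
    (hxU : x ∈ U) (hx : x ∈ e.source) (hx' : x ∈ e'.source) (v : E) :
    dirDeriv (chartFun e g) (chartMap e x) v =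
      dirDeriv (chartFun e' g) (chartMap e' x)
        (dirDeriv (chartChange e e') (chartMap e x) v) := by
  have e1 : chartChange e e' (chartMap e x) = chartMap e' x := chartFun_chartMap hx _
  rw [← e1]
  refine dirDeriv_comp (cOpen_chartImage e (hU.inter e'.open_source))
    ((he.convSmoothOn_chartChange he').mono (chartImage_mono inter_subset_right))
    (cOpen_chartImage e' hU) (he'.convSmoothOn_chartFun h)
    (fun y hy => (chartFun_chartChange hy g).symm)
    (chartMap_mem_chartImage hx ⟨hxU, hx'⟩) ?_ v
  rw [e1]
  exact chartMap_mem_chartImage hx' hxU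

theorem dirDeriv_congr {f g : E → F} {O : Set E} (hO : COpen O) (h : EqOn f g O) {y : E}
    (hy : y ∈ O) (u : E) : dirDeriv f y u = dirDeriv g y u := by
  refine congrArg lim (map_congr ?_)
  have h1 : ∀ᶠ t : ℝ in 𝓝 0, y + t • u ∈ O :=
    (hO _ (smoothCurve_line y u)).mem_nhds (show (0 : ℝ) ∈ _ by simpa using hy)
  filter_upwards [h1.filter_mono nhdsWithin_le_nhds] with t ht
  rw [h ht, h hy]

theorem iterDeriv_congr {f g : E → ℝ} {O : Set E} (hO : COpen O) (us : List E)
    (h : EqOn f g O) : EqOn (iterDeriv us f) (iterDeriv us g) O := by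
  induction us generalizing f g with
  | nil => exact h
  | cons u us ih => exact ih fun y hy => dirDeriv_congr hO h hy u

theorem dirDeriv_linear (l : E →ₗ[ℝ] ℝ) (y u : E) : dirDeriv (fun z => l z) y u = l u := by
  refine dirDeriv_eq (hasCurveDeriv_real_iff.2 ?_)
  simpa using ((hasDerivAt_id (0 : ℝ)).mul_const (l u)).const_add (l y)

theorem iterDeriv_const (us : List E) (k : ℝ) (y : E) :
    iterDeriv us (fun _ => k) y = if us = [] then k else 0 := by
  induction us generalizing k with
  | nil => rfl
  | cons u us ih =>
    have h : (fun z : E => dirDeriv (fun _ => k) z u) = fun _ => 0 :=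
      funext fun z => dirDeriv_eq (hasCurveDeriv_const k 0)
    simp only [iterDeriv, h, ih]
    simp

theorem dirDeriv_bornDual_comp {f : E → F} {O : Set E} (hO : COpen O) (hf : ConvSmoothOn f O)
    {x : E} (hx : x ∈ O) (l : bornDual F) (v : E) :
    dirDeriv (fun y => (l : F →ₗ[ℝ] ℝ) (f y)) x v = (l : F →ₗ[ℝ] ℝ) (dirDeriv f x v) := by
  obtain ⟨c, hc, hcf⟩ := hf.exists_extension hO (smoothCurve_line x v) (t := 0)
    (by simpa using hx)
  refine dirDeriv_eq ((hc.hasCurveDeriv_bornDual l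
    ((hf.hasCurveDeriv_line hO hx v).congr hcf)).congr ?_)
  filter_upwards [hcf] with s hs
  rw [hs]

end Manifold

section Poisson

variable {E F M : Type*} [AddCommGroup E] [Module ℝ E] [TopologicalSpace E]
  [AddCommGroup F] [Module ℝ F] [TopologicalSpace F]
  [TopologicalSpace M] [ChartedSpace (CInf E) M] [ConvenientSpace E]

/-! ### Differentials of admissible functions -/

namespace WeakCotangentSubbundle

variable (T : WeakCotangentSubbundle E F M)

theorem chartAt_mem (x : M) : T.chartAt x ∈ T.charts := (T.cover x).choose_spec.1

theorem mem_chartAt_source (x : M) : x ∈ (T.chartAt x).source := (T.cover x).choose_spec.2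

variable {T} {e e' : OpenPartialHomeomorph M (CInf E)}

theorem admissible_mono {U V : Set M} (h : V ⊆ U) {f : M → ℝ} (hf : f ∈ T.admissible U) :
    f ∈ T.admissible V :=
  ⟨fun a ha => (hf.1 a ha).mono (chartImage_mono h), fun x hx => hf.2 x (h hx)⟩

/-- The linear functions of a trivializing chart with differential in the fibre are admissible. -/
theorem linear_mem_admissible (he : e ∈ T.charts) {V : Set M} (hV : V ⊆ e.source) (α : F) :
    (fun x => (T.incl e α : E →ₗ[ℝ] ℝ) (chartMap e x)) ∈ T.admissible V := by
  constructor
  · intro a ha c hc hcV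
    exact (((T.isSmoothChart e he a ha).2.mono (chartImage_mono hV)) c hc hcV).boundedLinear
      (T.incl e α)
  · intro x hx
    -- In its own chart the function is linear: the first differential is `α` and all higher ones
    -- vanish.
    refine ⟨e, he, hV hx, fun us => ⟨if us = [] then α else 0, fun u => ?_⟩⟩
    have h1 : EqOn (chartFun e fun x => (T.incl e α : E →ₗ[ℝ] ℝ) (chartMap e x))
        (fun y => (T.incl e α : E →ₗ[ℝ] ℝ) y) (chartImage e univ) := fun y hy =>
      congrArg (T.incl e α : E →ₗ[ℝ] ℝ) (chartMap_symm hy)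
    have h2 := iterDeriv_congr (cOpen_chartImage e isOpen_univ) (u :: us) h1
      (chartMap_mem_chartImage (hV hx) (mem_univ x))
    rw [h2]
    simp only [iterDeriv, dirDeriv_linear, iterDeriv_const]
    split_ifs <;> simp

/-- Injectivity of `incl e` removes the ambiguity of the choice in `diff`. -/
theorem diff_eq (he : e ∈ T.charts) {f : M → ℝ} {x : M} {α : F}
    (h : ∀ u, (T.incl e α : E →ₗ[ℝ] ℝ) u = dirDeriv (chartFun e f) (chartMap e x) u) :
    T.diff e f x = α := by
  refine T.incl_injective e he (Subtype.ext (LinearMap.ext fun u => ?_))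
  rw [h u]
  exact Classical.epsilon_spec (p := fun α : F => ∀ u : E,
    (T.incl e α : E →ₗ[ℝ] ℝ) u = dirDeriv (chartFun e f) (chartMap e x) u) ⟨α, h⟩ u

/-- A covector of the fibre of `T♭M`, read in another trivializing chart. -/
theorem exists_transition (he : e ∈ T.charts) (he' : e' ∈ T.charts) {x : M} (hx : x ∈ e.source)
    (hx' : x ∈ e'.source) (α : F) : ∃ β : F, ∀ v, (T.incl e β : E →ₗ[ℝ] ℝ) v =
      (T.incl e' α : E →ₗ[ℝ] ℝ) (dirDeriv (chartChange e e') (chartMap e x) v) := by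
  obtain ⟨τ, -, hτ⟩ := T.transition e he e' he'
  exact ⟨_, hτ _ (chartMap_mem_chartImage hx hx') α⟩

theorem diff_linear (he : e ∈ T.charts) (he' : e' ∈ T.charts) {x : M} (hx : x ∈ e.source)
    (hx' : x ∈ e'.source) {α β : F} (h : ∀ v, (T.incl e β : E →ₗ[ℝ] ℝ) v =
      (T.incl e' α : E →ₗ[ℝ] ℝ) (dirDeriv (chartChange e e') (chartMap e x) v)) :
    T.diff e (fun x => (T.incl e' α : E →ₗ[ℝ] ℝ) (chartMap e' x)) x = β := by
  refine diff_eq he fun u => ?_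
  rw [h u]
  exact (dirDeriv_bornDual_comp (cOpen_chartImage e e'.open_source)
    ((T.isSmoothChart e he).convSmoothOn_chartChange (T.isSmoothChart e' he'))
    (chartMap_mem_chartImage hx hx') (T.incl e' α) u).symm

end WeakCotangentSubbundle

/-! ### Casimir functions -/

namespace PoissonAnchor

variable {T : WeakCotangentSubbundle E F M} {P : PoissonAnchor T}
  {e e' : OpenPartialHomeomorph M (CInf E)} {U V N : Set M} {C : M → ℝ}

/-- The bracket is defined in the chosen chart `T.chartAt x`. Since anchor values and differentials
transform by the same tangent map of the chart change, it can be computed in any trivializing chart.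
-/
theorem bracket_eq (hC : SmoothFunOn E C U) (hU : IsOpen U) (he : e ∈ T.charts) {x : M}
    (hx : x ∈ e.source) (hxU : x ∈ U) {f : M → ℝ} {α : F}
    (h : ∀ v, (T.incl (T.chartAt x) (T.diff (T.chartAt x) f x) : E →ₗ[ℝ] ℝ) v =
      (T.incl e α : E →ₗ[ℝ] ℝ)
        (dirDeriv (chartChange (T.chartAt x) e) (chartMap (T.chartAt x) x) v)) :
    P.bracket C f x =
      -dirDeriv (chartFun e C) (chartMap e x) (P.loc e (chartMap e x) α) := by
  rw [bracket, hamVec, P.compatible _ (T.chartAt_mem x) e he x ⟨T.mem_chartAt_source x, hx⟩ _ α h,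
    (T.isSmoothChart _ (T.chartAt_mem x)).dirDeriv_chartFun (T.isSmoothChart e he) hU hC hxU
      (T.mem_chartAt_source x) hx]

/-- The test function is the linear function of the chart `e` with differential `α`; it is
admissible on `V` because `V` lies in the chart domain. -/
theorem IsCasimir.dirDeriv_eq_zero (hC : P.IsCasimir V C) (hV : IsOpen V) (he : e ∈ T.charts)
    (hVe : V ⊆ e.source) {x : M} (hx : x ∈ V) (α : F) :
    dirDeriv (chartFun e C) (chartMap e x) (P.loc e (chartMap e x) α) = 0 := by
  obtain ⟨β, hβ⟩ := WeakCotangentSubbundle.exists_transition (T.chartAt_mem x) he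
    (T.mem_chartAt_source x) (hVe hx) α
  have h1 := hC.2 _ (WeakCotangentSubbundle.linear_mem_admissible he hVe α) x hx
  rw [bracket_eq hC.1.1 hV he (hVe hx) hx (α := α), neg_eq_zero] at h1
  · exact h1
  · rw [WeakCotangentSubbundle.diff_linear (T.chartAt_mem x) he (T.mem_chartAt_source x) (hVe hx)
      hβ]
    exact hβ

/-- At a point, the bracket with `C` sees only the covector `df`, and every covector is already
realized by a linear function admissible on all of `U`. -/
theorem IsCasimir.isLocalCasimir (hC : P.IsCasimir U C) (hU : IsOpen U) (he : e ∈ T.charts)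
    (hUe : U ⊆ e.source) : P.IsLocalCasimir U C := by
  refine fun V hV hVU => ⟨WeakCotangentSubbundle.admissible_mono hVU hC.1, fun f _ x hx => ?_⟩
  have hx0 := T.chartAt_mem x
  have hxe := hUe (hVU hx)
  obtain ⟨β, hβ⟩ := WeakCotangentSubbundle.exists_transition he hx0 hxe
    (T.mem_chartAt_source x) (T.diff (T.chartAt x) f x)
  rw [bracket, hamVec, P.compatible e he _ hx0 x ⟨hxe, T.mem_chartAt_source x⟩ β _ hβ,
    ← (T.isSmoothChart e he).dirDeriv_chartFun (T.isSmoothChart _ hx0) hU hC.1.1 (hVU hx) hxe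
      (T.mem_chartAt_source x), hC.dirDeriv_eq_zero hU he hUe (hVU hx), neg_zero]

theorem IsLocalCasimir.smoothFunOn (hC : P.IsLocalCasimir U C) (hU : IsOpen U) :
    SmoothFunOn E C U := (hC U hU Subset.rfl).1.1

theorem IsLocalCasimir.dirDeriv_eq_zero (hC : P.IsLocalCasimir U C) (hU : IsOpen U)
    (he : e ∈ T.charts) {x : M} (hxU : x ∈ U) (hx : x ∈ e.source) {v : E}
    (hv : v ∈ P.charDist e x) : dirDeriv (chartFun e C) (chartMap e x) v = 0 := by
  obtain ⟨α, rfl⟩ := hv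
  exact (hC _ (hU.inter e.open_source) inter_subset_left).dirDeriv_eq_zero
    (hU.inter e.open_source) he inter_subset_right ⟨hxU, hx⟩ α

/-! ### Constancy along integral curves -/

theorem eq_of_hasDerivAt_zero {g : ℝ → ℝ} {I : Set ℝ} (hI : IsOpen I) (hI' : I.OrdConnected)
    (h : ∀ t ∈ I, HasDerivAt g 0 t) {s t : ℝ} (hs : s ∈ I) (ht : t ∈ I) : g s = g t :=
  hI.is_const_of_deriv_eq_zero hI'.isPreconnected
    (fun t ht => (h t ht).differentiableAt.differentiableWithinAt) (fun t ht => (h t ht).deriv)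
    hs ht

/-- By the chain rule the derivative of `C ∘ c` at `t` is `dC(X_H) = -{C, H}`, read in the very
chart `T.chartAt (c t)` that defines the bracket. -/
theorem IsCasimir.eq_on_integralCurve (hC : P.IsCasimir U C) (hU : IsOpen U) {H : M → ℝ}
    (hH : H ∈ T.admissible U) {c : ℝ → M} {I : Set ℝ} (hc : P.IsIntegralCurve H c I)
    (hcU : MapsTo c I U) {s t : ℝ} (hs : s ∈ I) (ht : t ∈ I) : C (c s) = C (c t) := by
  obtain ⟨hI, hI', hcont, hcurve⟩ := hc
  refine eq_of_hasDerivAt_zero (g := fun t => C (c t)) hI hI' (fun t ht => ?_) hs ht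
  have he := T.chartAt_mem (c t)
  have hx := T.mem_chartAt_source (c t)
  obtain ⟨h1, h2⟩ := hcurve _ he
  have hJ := hcont.isOpen_inter_preimage hI (T.chartAt (c t)).open_source
  have h3 := ((T.isSmoothChart _ he).convSmoothOn_chartFun hC.1.1).hasCurveDeriv_comp
    (cOpen_chartImage _ hU) hJ h1 ⟨ht, hx⟩ (chartMap_mem_chartImage hx (hcU ht)) (h2 t ⟨ht, hx⟩)
  rw [neg_eq_zero.1 (hC.2 H hH (c t) (hcU ht))] at h3
  refine (hasCurveDeriv_real_iff.1 h3).congr_of_eventuallyEq ?_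
  filter_upwards [hJ.mem_nhds ⟨ht, hx⟩] with s hs
  exact (chartFun_chartMap hs.2 C).symm

/-! ### Constancy on submanifolds -/

theorem eq_on_connectedComponentIn {Y : Type*} [TopologicalSpace Y] {A : Set Y} {f : Y → ℝ}
    (h : ∀ x ∈ A, ∀ᶠ y in 𝓝[A] x, f y = f x) {x y : Y} (hx : x ∈ A)
    (hy : y ∈ connectedComponentIn A x) : f y = f x := by
  have hsub := connectedComponentIn_subset A x
  refine isPreconnected_connectedComponentIn.induction₂ (fun y x => f y = f x)
    (fun z hz => ?_) (fun _ _ _ _ _ _ => Eq.trans) (fun _ _ _ _ => Eq.symm) hy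
    (mem_connectedComponentIn hx)
  exact ((h z (hsub hz)).filter_mono (nhdsWithin_mono z hsub)).mono fun _ => Eq.symm

/-- The submanifold chart `φ` need not trivialize `T♭M`. The velocity is carried to a trivializing
chart `e`, where it is tangent to `N`, hence in the distribution, hence killed by `dC`. -/
theorem IsLocalCasimir.hasDerivAt_zero_of_mem (hC : P.IsLocalCasimir U C) (hU : IsOpen U)
    (hN : ∀ x ∈ N, ∀ e ∈ T.charts, x ∈ e.source → tangentSet e N x ⊆ P.charDist e x)
    {φ : OpenPartialHomeomorph M (CInf E)} (hφ : IsSmoothChart φ) {γ : ℝ → E}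
    (hγ : SmoothCurve γ) {t : ℝ} (hγN : ∀ᶠ s in 𝓝 t, γ s ∈ chartImage φ (U ∩ N)) :
    HasDerivAt (fun s => chartFun φ C (γ s)) 0 t := by
  have ht := hγN.self_of_nhds
  obtain ⟨e, he, hxe⟩ := T.cover (φ.symm (toCInf (γ t)))
  have hes := T.isSmoothChart e he
  have hxφ := symm_mem_source ht
  have hφx := chartMap_symm ht
  obtain ⟨v, -, hv⟩ := hγ.hasCurveDeriv
  have hO := cOpen_chartImage φ e.open_source
  -- A member of `tangentSet` needs a curve that stays in `N` and in the chart for all time.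
  obtain ⟨ρ, hρ, hρ1, hρ2⟩ := exists_localizing_reparam
    (inter_mem hγN ((hO γ hγ).mem_nhds ⟨ht.1, hxe⟩))
  have hch := hφ.convSmoothOn_chartChange hes
  have hη : SmoothCurve fun s => chartChange φ e (γ (ρ s)) :=
    hch _ (hγ.comp hρ) fun s => (hρ1 s).2
  have h1 := hch.hasCurveDeriv_comp hO isOpen_univ hγ (mem_univ t) ⟨ht.1, hxe⟩ (hv t)
  have htan : dirDeriv (chartChange φ e) (γ t) (v t) ∈
      tangentSet e N (φ.symm (toCInf (γ t))) := by
    refine ⟨fun s => chartChange φ e (γ (ρ (t + s))),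
      hη.comp (contDiff_const.add contDiff_id), ?_, fun s => ?_, ?_⟩
    · simp only [add_zero, hρ2.self_of_nhds]
      rfl
    · exact mapsTo_chartChange ⟨(hρ1 _).1.1, (hρ1 _).1.2.2, (hρ1 _).2.2⟩
    · have h2 : HasCurveDeriv (fun s => chartChange φ e (γ (ρ s)))
          (dirDeriv (chartChange φ e) (γ t) (v t)) (t + 0) := by
        rw [add_zero]
        refine h1.congr ?_
        filter_upwards [hρ2] with s hs
        rw [hs]
      simpa using h2.comp ((hasDerivAt_id (0 : ℝ)).const_add t)
  have h3 := (hφ.convSmoothOn_chartFun (hC.smoothFunOn hU)).hasCurveDeriv_comp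
    (cOpen_chartImage φ hU) isOpen_univ hγ (mem_univ t) (chartImage_mono inter_subset_left ht)
    (hv t)
  have h4 := hφ.dirDeriv_chartFun hes hU (hC.smoothFunOn hU) ht.2.1 hxφ hxe (v t)
  rw [hφx, hC.dirDeriv_eq_zero hU he ht.2.1 hxe (hN _ ht.2.2 e he hxe htan)] at h4
  rw [h4] at h3
  exact hasCurveDeriv_real_iff.1 h3

/-- If a smooth curve meets `A` at times arbitrarily close to `t₀`, but not at `t₀`, and `A` is
contained in a linear subspace `S` that also contains `c t₀`, then some smooth curve in `S` through
`c t₀` meets `A` at times converging to `0`. -/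
theorem exists_smoothCurve_in_submodule {c : ℝ → E} (hc : SmoothCurve c) {t₀ : ℝ} {A : Set E}
    {S : Submodule ℝ E} (hAS : A ⊆ S) (h0 : c t₀ ∈ S) (h0A : c t₀ ∉ A)
    (hA : ∃ᶠ t in 𝓝 t₀, c t ∈ A) :
    ∃ Γ : ℝ → E, SmoothCurve Γ ∧ Γ 0 = c t₀ ∧ (∀ s, Γ s ∈ S) ∧ ∀ n : ℕ, Γ ((1 / 2) ^ n) ∈ A := by
  -- Times this close to `t₀` make `t n - t₀` admissible as coefficients of a special curve, whose
  -- vectors are the bounded difference quotients of `c`.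
  have hex : ∀ n : ℕ, ∃ t, c t ∈ A ∧ |t - t₀| < (1 / 2) ^ (n ^ 2) := fun n => by
    obtain ⟨t, ht, ht'⟩ := (hA.and_eventually (Metric.ball_mem_nhds t₀
      (show (0 : ℝ) < (1 / 2) ^ (n ^ 2) by positivity))).exists
    exact ⟨t, ht, by simpa [Real.dist_eq] using ht'⟩
  choose t htA ht using hex
  have hne : ∀ n, t n - t₀ ≠ 0 := fun n h => h0A (by rw [← sub_eq_zero.1 h]; exact htA n)
  have ht0 : Tendsto (fun n => t n - t₀) atTop (𝓝 0) :=
    squeeze_zero_norm (fun n => (ht n).le) tendsto_half_pow_sq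
  have hy : Bornology.IsVonNBounded ℝ (range fun n => (t n - t₀)⁻¹ • (c (t n) - c t₀)) := by
    obtain ⟨c', -, hc'⟩ := hc.hasCurveDeriv
    refine Tendsto.isVonNBounded_range ℝ (x := c' t₀) ?_
    have h3 := Tendsto.comp (hc' t₀)
      (tendsto_nhdsWithin_iff.2 ⟨ht0, Eventually.of_forall hne⟩)
    simpa only [Function.comp_def, add_sub_cancel] using h3
  let ψ : ContDiffBump (0 : ℝ) := ⟨1 / 8, 1 / 4, by norm_num, by norm_num⟩
  obtain ⟨γ, hγ, hγ0, hγ1, hγ2⟩ := exists_special_curve (fun n => (ht n).le) ψ.contDiff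
    ψ.tsupport_eq.le hy
  refine ⟨fun s => c t₀ + γ s, (smoothCurve_const _).add hγ, by simp [hγ0], fun s => ?_,
    fun n => ?_⟩
  -- Each value of `γ` is a multiple of a single difference quotient, which lies in `S`.
  · obtain ⟨n, r, h⟩ := hγ2 s
    simp only [h]
    exact S.add_mem h0 (S.smul_mem _ (S.smul_mem _ (S.sub_mem (hAS (htA n)) h0)))
  · have h1 : ψ 0 = 1 := ψ.one_of_mem_closedBall (by simp [ψ])
    have h2 := hγ1 n 0 (by simp)
    rw [add_zero, mul_one, h1, mul_one, smul_inv_smul₀ (hne n)] at h2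
    simp only [h2, add_sub_cancel]
    exact htA n

/-- Closedness of `S` makes its trace `c^∞`-topology detectable by smooth curves inside `S`: a limit
along a curve stays in `S`, and the special curve replaces the given one. `C` is constant along
curves in `S`. -/
theorem IsLocalCasimir.eventually_eq_of_isSubmanifold (hC : P.IsLocalCasimir U C)
    (hU : IsOpen U) (hNs : IsSubmanifold E N)
    (hN : ∀ x ∈ N, ∀ e ∈ T.charts, x ∈ e.source → tangentSet e N x ⊆ P.charDist e x)
    {x : M} (hx : x ∈ U ∩ N) : ∀ᶠ y in 𝓝[U ∩ N] x, C y = C x := by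
  obtain ⟨φ, hφ, hxφ, S, hS, hNS⟩ := hNs x hx.2
  have hO := cOpen_chartImage φ hU
  have hmem : ∀ y ∈ chartImage φ U, y ∈ S → y ∈ chartImage φ (U ∩ N) := fun y hy hyS =>
    ⟨hy.1, hy.2, (hNS _ (symm_mem_source hy)).2 (by rwa [chartMap_symm hy])⟩
  -- Openness is tested by curves that may leave `S`, so the value of `C` is constrained only on
  -- `S`.
  let G : Set E := {y | y ∈ chartImage φ U ∧ (y ∈ S → chartFun φ C y = C x)}
  have hG : COpen G := by
    intro c hc
    refine isOpen_iff_mem_nhds.2 fun t₀ ht₀ => ?_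
    by_contra hcon
    let A : Set E := {y | y ∈ chartImage φ U ∧ y ∈ S ∧ chartFun φ C y ≠ C x}
    have hA : ∃ᶠ t in 𝓝 t₀, c t ∈ A := by
      have h1 : ∃ᶠ t in 𝓝 t₀, t ∉ c ⁻¹' G :=
        fun h => hcon (h.mono fun _ => not_not.1)
      refine (h1.and_eventually ((hO c hc).mem_nhds ht₀.1)).mono ?_
      rintro t ⟨h2, h3⟩
      by_contra h4
      refine h2 ⟨h3, fun h5 => ?_⟩
      by_contra h6
      exact h4 ⟨h3, h5, h6⟩
    have h0S : c t₀ ∈ S := by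
      by_contra h
      have h1 : IsOpen {t | c t ∉ S} := hS.isOpen_compl c hc
      obtain ⟨t, h2, h3⟩ := (hA.and_eventually (h1.mem_nhds h)).exists
      exact h3 h2.2.1
    obtain ⟨Γ, hΓ, hΓ0, hΓS, hΓA⟩ := exists_smoothCurve_in_submodule hc (fun _ h => h.2.1) h0S
      (fun h => h.2.2 (ht₀.2 h0S)) hA
    obtain ⟨ε, hε, hball⟩ := Metric.isOpen_iff.1 (hO Γ hΓ) 0
      (show Γ 0 ∈ chartImage φ U by rw [hΓ0]; exact ht₀.1)
    have hd : ∀ s ∈ Metric.ball (0 : ℝ) ε, HasDerivAt (fun s => chartFun φ C (Γ s)) 0 s :=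
      fun s hs => hC.hasDerivAt_zero_of_mem hU hN hφ hΓ (by
        filter_upwards [Metric.isOpen_ball.mem_nhds hs] with r hr
        exact hmem _ (hball hr) (hΓS r))
    obtain ⟨n, hn⟩ := exists_pow_lt_of_lt_one hε (show (1 / 2 : ℝ) < 1 by norm_num)
    have h5 := eq_of_hasDerivAt_zero Metric.isOpen_ball
      (by rw [Real.ball_eq_Ioo]; exact ordConnected_Ioo) hd
      (show (1 / 2 : ℝ) ^ n ∈ Metric.ball 0 ε by
        rw [Metric.mem_ball, Real.dist_eq, sub_zero, abs_of_pos (by positivity)]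
        exact hn) (Metric.mem_ball_self hε)
    simp only [hΓ0, ht₀.2 h0S] at h5
    exact (hΓA n).2.2 h5
  have hW := isOpen_source_inter_preimage φ hG
  have hxG : x ∈ φ.source ∩ chartMap φ ⁻¹' G :=
    ⟨hxφ, chartMap_mem_chartImage hxφ hx.1, fun _ => chartFun_chartMap hxφ C⟩
  filter_upwards [mem_nhdsWithin_of_mem_nhds (hW.mem_nhds hxG), self_mem_nhdsWithin] with y hy hyN
  rw [← chartFun_chartMap hy.1 C]
  exact hy.2.2 ((hNS y hy.1).1 hyN.2)

/-! ### Constancy on weak submanifolds -/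

section WeakSubmanifold

variable {E' L : Type*} [AddCommGroup E'] [Module ℝ E'] [TopologicalSpace E']
  [ConvenientSpace E'] [TopologicalSpace L] [ChartedSpace (CInf E') L]

theorem convSmoothOn_chartFun_chartMap [ConvenientManifold E M] {ι : L → M}
    (hι : IsWeakSubmanifold E E' ι) {a : OpenPartialHomeomorph L (CInf E')}
    (ha : a ∈ atlas (CInf E') L) (he : IsSmoothChart e) :
    ConvSmoothOn (chartFun a fun w => chartMap e (ι w)) (chartImage a (ι ⁻¹' e.source)) := by
  refine convSmoothOn_of_locally fun y hy => ?_
  let b := ChartedSpace.chartAt (H := CInf E) (ι (a.symm (toCInf y)))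
  have hb : b ∈ atlas (CInf E) M := chart_mem_atlas _ _
  refine ⟨chartImage a (ι ⁻¹' b.source), cOpen_chartImage a (b.open_source.preimage hι.1),
    ⟨hy.1, mem_chart_source _ _⟩, ?_⟩
  refine (((isSmoothChart_of_mem_atlas hb).convSmoothOn_chartChange he).comp
    ((hι.2.1 a ha b hb).mono inter_subset_right) fun z hz => ?_).congr fun z hz => ?_
  · exact chartMap_mem_chartImage hz.2.2 hz.1.2
  · exact (chartFun_chartMap (e := b) hz.2.2 (chartMap e)).symm

/-- Every smooth curve in a chart of `L` is sent to a curve tangent to the distribution, so the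
level set of `C ∘ ι` is `c^∞`-open; the topology of `L` is read in its own charts, and no special
curve is needed. -/
theorem IsLocalCasimir.eventually_eq_of_isWeakSubmanifold [ConvenientManifold E M]
    (hC : P.IsLocalCasimir U C) (hU : IsOpen U) {ι : L → M} (hι : IsWeakSubmanifold E E' ι)
    (hd : ∀ z : L, ∀ a ∈ atlas (CInf E') L, ∀ e ∈ T.charts, z ∈ a.source → ι z ∈ e.source →
      range (tangentMap a e ι z) ⊆ P.charDist e (ι z)) {z : L} (hz : z ∈ ι ⁻¹' U) :
    ∀ᶠ w in 𝓝 z, C (ι w) = C (ι z) := by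
  let a := ChartedSpace.chartAt (H := CInf E') z
  have ha : a ∈ atlas (CInf E') L := chart_mem_atlas _ _
  have hza : z ∈ a.source := mem_chart_source _ _
  obtain ⟨e, he, hze⟩ := T.cover (ι z)
  have hes := T.isSmoothChart e he
  have hW : IsOpen (ι ⁻¹' (U ∩ e.source)) := (hU.inter e.open_source).preimage hι.1
  have hO := cOpen_chartImage a hW
  have hh := (convSmoothOn_chartFun_chartMap hι ha hes).mono
    (chartImage_mono (e := a) (show ι ⁻¹' (U ∩ e.source) ⊆ _ from fun _ h => h.2))
  have hf := hes.convSmoothOn_chartFun (hC.smoothFunOn hU)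
  have hm : MapsTo (chartFun a fun w => chartMap e (ι w)) (chartImage a (ι ⁻¹' (U ∩ e.source)))
      (chartImage e U) := fun y hy => chartMap_mem_chartImage hy.2.2 hy.2.1
  have hfh : ∀ y ∈ chartImage a (ι ⁻¹' (U ∩ e.source)), chartFun a (fun w => C (ι w)) y =
      chartFun e C (chartFun a (fun w => chartMap e (ι w)) y) := fun y hy =>
    (chartFun_chartMap (e := e) hy.2.2 C).symm
  have hg : ConvSmoothOn (chartFun a fun w => C (ι w)) (chartImage a (ι ⁻¹' (U ∩ e.source))) :=
    (hf.comp hh hm).congr hfh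
  let G : Set E' := {y | y ∈ chartImage a (ι ⁻¹' (U ∩ e.source)) ∧
    chartFun a (fun w => C (ι w)) y = C (ι z)}
  have hG : COpen G := by
    intro c hc
    refine Metric.isOpen_iff.2 fun t₀ ht₀ => ?_
    obtain ⟨ε, hε, hball⟩ := Metric.isOpen_iff.1 (hO c hc) t₀ ht₀.1
    refine ⟨ε, hε, fun t ht => ⟨hball ht, ?_⟩⟩
    rw [← ht₀.2]
    obtain ⟨c', -, hc'⟩ := hc.hasCurveDeriv
    refine eq_of_hasDerivAt_zero (g := fun t => chartFun a (fun w => C (ι w)) (c t))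
      Metric.isOpen_ball (by rw [Real.ball_eq_Ioo]; exact ordConnected_Ioo) (fun s hs => ?_) ht
      (Metric.mem_ball_self hε)
    have hs' : c s ∈ chartImage a (ι ⁻¹' (U ∩ e.source)) := hball hs
    have h1 := hg.hasCurveDeriv_comp hO isOpen_univ hc (mem_univ s) hs' (hc' s)
    rw [dirDeriv_comp hO hh (cOpen_chartImage e hU) hf hfh hs' (hm hs')] at h1
    have h2 : dirDeriv (chartFun a fun w => chartMap e (ι w)) (c s) (c' s) ∈
        P.charDist e (ι (a.symm (toCInf (c s)))) := by
      refine hd _ a ha e he (symm_mem_source hs') hs'.2.2 ⟨c' s, ?_⟩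
      rw [tangentMap, chartMap_symm hs']
    have h3 := hC.dirDeriv_eq_zero hU he hs'.2.1 hs'.2.2 h2
    refine hasCurveDeriv_real_iff.1 ?_
    rwa [← h3]
  have hWG := isOpen_source_inter_preimage a hG
  filter_upwards [hWG.mem_nhds ⟨hza, chartMap_mem_chartImage hza ⟨hz, hze⟩,
    chartFun_chartMap hza _⟩] with w hw
  rw [← hw.2.2]
  exact (chartFun_chartMap (e := a) hw.1 fun w => C (ι w)).symm

end WeakSubmanifold

end PoissonAnchor

end Poisson

end Convenient

end

/-! ### The proposition: from local constancy to connected components. -/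

theorem mainTheorem12 {E F M : Type*}
    [AddCommGroup E] [Module ℝ E] [TopologicalSpace E] [Convenient.ConvenientSpace E]
    [AddCommGroup F] [Module ℝ F] [TopologicalSpace F] [Convenient.ConvenientSpace F]
    [TopologicalSpace M] [ChartedSpace (Convenient.CInf E) M] [Convenient.ConvenientManifold E M]
    (T : Convenient.WeakCotangentSubbundle E F M) (P : Convenient.PoissonAnchor T)
    (hP : P.IsPartialPoisson) (U : Set M) (hU : IsOpen U) (C : M → ℝ) :
    -- local Casimir functions on submanifolds and leaves
    (P.IsLocalCasimir U C →
      (∀ N : Set M, Convenient.IsSubmanifold E N →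
        (∀ x ∈ N, ∀ e ∈ T.charts, x ∈ e.source →
          Convenient.tangentSet e N x ⊆ P.charDist e x) →
        ∀ x ∈ U ∩ N, ∀ y ∈ connectedComponentIn (U ∩ N) x, C y = C x) ∧
      (∀ N : Set M, P.IsClosedLeaf N → IsPreconnected (U ∩ N) →
        ∀ x ∈ U ∩ N, ∀ y ∈ U ∩ N, C x = C y) ∧
      (∀ {E' L : Type*} [AddCommGroup E'] [Module ℝ E'] [TopologicalSpace E']
        [Convenient.ConvenientSpace E'] [TopologicalSpace L]
        [ChartedSpace (Convenient.CInf E') L] [Convenient.ConvenientManifold E' L] (ι : L → M),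
        Convenient.IsWeakSubmanifold E E' ι →
        (∀ z : L, ∀ a ∈ atlas (Convenient.CInf E') L, ∀ e ∈ T.charts,
          z ∈ a.source → ι z ∈ e.source →
          range (Convenient.tangentMap a e ι z) ⊆ P.charDist e (ι z)) →
        ∀ z ∈ ι ⁻¹' U, ∀ w ∈ connectedComponentIn (ι ⁻¹' U) z, C (ι w) = C (ι z))) ∧
    -- functions that Poisson-commute with `𝔄(U)` only
    (P.IsCasimir U C →
      (∀ e ∈ T.charts, U ⊆ e.source → P.IsLocalCasimir U C) ∧
      (∀ H ∈ T.admissible U, ∀ (c : ℝ → M) (I : Set ℝ), P.IsIntegralCurve H c I →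
        MapsTo c I U → ∀ s ∈ I, ∀ t ∈ I, C (c s) = C (c t))) := by
  refine ⟨fun hC => ⟨fun N hN hTN x hx y hy => ?_, fun N hN hUN x hx y hy => ?_, ?_⟩,
    fun hC => ⟨fun e he hUe => hC.isLocalCasimir hU he hUe,
      fun H hH c I hc hcU s hs t ht => hC.eq_on_integralCurve hU hH hc hcU hs ht⟩⟩
  · exact Convenient.PoissonAnchor.eq_on_connectedComponentIn
      (fun z hz => hC.eventually_eq_of_isSubmanifold hU hN hTN hz) hx hy
  · obtain ⟨-, -, hNs, hTN⟩ := hN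
    exact Convenient.PoissonAnchor.eq_on_connectedComponentIn
      (fun z hz => hC.eventually_eq_of_isSubmanifold hU hNs
        (fun x hx e he hxe => (hTN x hx e he hxe).subset) hz) hy
      (by rwa [hUN.connectedComponentIn hy])
  · intro E' L _ _ _ _ _ _ _ ι hι hd z hz w hw
    exact Convenient.PoissonAnchor.eq_on_connectedComponentIn (f := fun w => C (ι w))
      (fun z hz => (hC.eventually_eq_of_isWeakSubmanifold hU hι hd hz).filter_mono
        nhdsWithin_le_nhds) hz hw
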